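/- Let $C$ be a quadric of a line of $\mathbb P_2=\mathbb P(\mathbb C^3)$, i.e. the subscheme $C=\{h=q=0\}$ where $h$ is a nonzero linear form and $q$ a quadratic form not divisible by $h$; thus $C$ consists of two distinct points, or is a double point on a line. Let $W_0\subset H^0(\mathbb P_2,\mathcal O(2))$ be the (4-dimensional) space of equations of conics containing $C$. A quadratic congruence with values in $\mathbb P(W_0)$ is a rational map $\sigma:\mathbb P_2\dashrightarrow\mathbb P(W_0)$ such that 1. $\sigma^*(\mathcal O(1))=\mathcal O(2)$; 2. $\sigma^*:W_0^*\to H^0(\mathbb P_2,\mathcal O(2))$ induces an isomorphism $W_0^*\simeq W_0$; 3. $P\in\sigma(P)$ for every point $P\in\mathbb P_2$ where $\sigma$ is defined, $\sigma(P)$ being seen as a conic of $\mathbb P_2$; 4. the isomorphism $\phi=(\sigma^*)^{-1}:W_0\to W_0^*$ (defined up to a nonzero scalar) is not antisymmetric. Let $\mathrm{Cong}(C)$ be the set of these congruences, and let $G_C\subset GL_3(\mathbb C)$ be the subgroup of the elements leaving $W_0$ invariant (equivalently, leaving $C$ invariant), acting on $\mathrm{Cong}(C)$ by $(\alpha.\sigma)(P)=\alpha^{-1}(\sigma(\alpha(P)))$.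 Let $GL(W_0)$ act on the set $\mathrm{Isom}(W_0,W_0^*)$ of linear isomorphisms by $\phi.g={}^tg\circ\phi\circ g$. Then $\sigma\mapsto(\sigma^*)^{-1}$ induces a well-defined map $$\mathrm{Cong}(C)/G_C\longrightarrow \mathrm{Isom}(W_0,W_0^*)/GL(W_0),$$ and all fibers of this map are finite. -/

import Mathlib

open MvPolynomial

namespace QuadCong

noncomputable section

/-! ### Linear changes of coordinates -/

/-- The pull-back `p ↦ p ∘ A` of polynomial functions along an invertible matrix `A`,
that is `(pullback A p)(x) = p (A x)`. -/
def pullbackHom {n : ℕ} (A : Matrix (Fin n) (Fin n) ℂ) :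
    MvPolynomial (Fin n) ℂ →ₐ[ℂ] MvPolynomial (Fin n) ℂ :=
  aeval (fun i => ∑ j, C (A i j) * X j)

theorem eval_pullbackHom {n : ℕ} (A : Matrix (Fin n) (Fin n) ℂ)
    (p : MvPolynomial (Fin n) ℂ) (x : Fin n → ℂ) :
    eval x (pullbackHom A p) = eval (A.mulVec x) p := by
  induction p using MvPolynomial.induction_on with
  | C a => simp [pullbackHom]
  | add p q hp hq => simp [hp, hq]
  | mul_X p i hp => simp [hp]; left; simp [pullbackHom, Matrix.mulVec, dotProduct]

theorem pullbackHom_mul {n : ℕ} (A B : Matrix (Fin n) (Fin n) ℂ)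
    (p : MvPolynomial (Fin n) ℂ) :
    pullbackHom (A * B) p = pullbackHom B (pullbackHom A p) := by
  apply MvPolynomial.funext
  intro x
  simp [eval_pullbackHom, Matrix.mulVec_mulVec]

theorem pullbackHom_one {n : ℕ} (p : MvPolynomial (Fin n) ℂ) :
    pullbackHom (1 : Matrix (Fin n) (Fin n) ℂ) p = p := by
  apply MvPolynomial.funext
  intro x
  simp [eval_pullbackHom]

/-- Pull-back of polynomials along an element of `GL(V)`, `V = ℂⁿ`. -/
def pullback {n : ℕ} (A : GL (Fin n) ℂ) :
    MvPolynomial (Fin n) ℂ ≃ₐ[ℂ] MvPolynomial (Fin n) ℂ :=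
  AlgEquiv.ofAlgHom (pullbackHom (A : Matrix (Fin n) (Fin n) ℂ))
    (pullbackHom ((A⁻¹ : GL (Fin n) ℂ) : Matrix (Fin n) (Fin n) ℂ))
    (by
      apply AlgHom.ext
      intro p
      have h := pullbackHom_mul ((A⁻¹ : GL (Fin n) ℂ) : Matrix (Fin n) (Fin n) ℂ)
        (A : Matrix (Fin n) (Fin n) ℂ) p
      rw [← Units.val_mul, inv_mul_cancel, Units.val_one, pullbackHom_one] at h
      simpa using h.symm)
    (by
      apply AlgHom.ext
      intro p
      have h := pullbackHom_mul (A : Matrix (Fin n) (Fin n) ℂ)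
        ((A⁻¹ : GL (Fin n) ℂ) : Matrix (Fin n) (Fin n) ℂ) p
      rw [← Units.val_mul, mul_inv_cancel, Units.val_one, pullbackHom_one] at h
      simpa using h.symm)

theorem pullback_apply {n : ℕ} (A : GL (Fin n) ℂ) (p : MvPolynomial (Fin n) ℂ) :
    pullback A p = pullbackHom (A : Matrix (Fin n) (Fin n) ℂ) p := rfl

theorem pullback_mul {n : ℕ} (A B : GL (Fin n) ℂ) (p : MvPolynomial (Fin n) ℂ) :
    pullback (A * B) p = pullback B (pullback A p) := by
  simp [pullback_apply, pullbackHom_mul]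

theorem pullback_one {n : ℕ} (p : MvPolynomial (Fin n) ℂ) :
    pullback (1 : GL (Fin n) ℂ) p = p := by
  simp [pullback_apply, pullbackHom_one]

theorem pullback_inv_apply {n : ℕ} (A : GL (Fin n) ℂ) (p : MvPolynomial (Fin n) ℂ) :
    pullback A⁻¹ (pullback A p) = p := by
  rw [← pullback_mul, mul_inv_cancel, pullback_one]

theorem pullback_apply_inv {n : ℕ} (A : GL (Fin n) ℂ) (p : MvPolynomial (Fin n) ℂ) :
    pullback A (pullback A⁻¹ p) = p := by
  rw [← pullback_mul, inv_mul_cancel, pullback_one]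

theorem isHomogeneous_pullback {n d : ℕ} (A : GL (Fin n) ℂ) {p : MvPolynomial (Fin n) ℂ}
    (hp : p.IsHomogeneous d) : (pullback A p).IsHomogeneous d := by
  have h := hp.aeval (fun i => ∑ j, C ((A : Matrix (Fin n) (Fin n) ℂ) i j) * X j) (n := 1)
    (fun i => IsHomogeneous.sum _ _ _ fun j _ => by
      simpa using (isHomogeneous_C (Fin n) _).mul (isHomogeneous_X ℂ j))
  simpa [pullback_apply, pullbackHom] using h

/-! ### Rational maps from `ℙ(ℂⁿ)` to `ℙ(W)` -/

/-- Homogeneous coordinates, in lowest terms, of a rational map `σ : ℙ(ℂⁿ) ⇢ ℙ(W)`: the linear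
map `σ^* : W^* → H⁰(ℙ(ℂⁿ), 𝒪(d))`, whose values are forms of degree `d` without common factor
(in particular not all zero).  One has `σ^*(𝒪(1)) = 𝒪(d)`. -/
structure RationalLift (n : ℕ) (W : Type*) [AddCommGroup W] [Module ℂ W] where
  /-- the integer `d` such that `σ^*(𝒪(1)) = 𝒪(d)` -/
  degree : ℕ
  /-- the map `σ^*` -/
  star : Module.Dual ℂ W →ₗ[ℂ] MvPolynomial (Fin n) ℂ
  homogeneous : ∀ l, (star l).IsHomogeneous degree
  coprime : ∀ p : MvPolynomial (Fin n) ℂ, (∀ l, p ∣ star l) → IsUnit p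

/-- `σ` is defined at the point `ℂ x`, and its value there is `ℂ w`; more precisely the lift
sends the nonzero vector `x` to the nonzero vector `w` of `W`.  (The map is undefined exactly at
the common zeros of all `σ^* l`.) -/
def RationalLift.MapsTo {n : ℕ} {W : Type*} [AddCommGroup W] [Module ℂ W]
    (F : RationalLift n W) (x : Fin n → ℂ) (w : W) : Prop :=
  x ≠ 0 ∧ w ≠ 0 ∧ ∀ l : Module.Dual ℂ W, l w = eval x (F.star l)

/-- Two reduced systems of homogeneous coordinates define the same rational map if and only if
they are proportional. -/
instance rationalLiftSetoid (n : ℕ) (W : Type*) [AddCommGroup W] [Module ℂ W] :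
    Setoid (RationalLift n W) where
  r F F' := ∃ c : ℂ, c ≠ 0 ∧ F'.star = c • F.star
  iseqv :=
    { refl := fun F => ⟨1, one_ne_zero, by simp⟩
      symm := by
        rintro F F' ⟨c, hc, h⟩
        exact ⟨c⁻¹, inv_ne_zero hc, by rw [h, smul_smul, inv_mul_cancel₀ hc, one_smul]⟩
      trans := by
        rintro F F' F'' ⟨c, hc, h⟩ ⟨d, hd, h'⟩
        exact ⟨d * c, mul_ne_zero hd hc, by rw [h', h, smul_smul]⟩ }

/-- Rational maps `ℙ(ℂⁿ) ⇢ ℙ(W)`. -/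
def RationalMap (n : ℕ) (W : Type*) [AddCommGroup W] [Module ℂ W] : Type _ :=
  Quotient (rationalLiftSetoid n W)

/-! ### Quadratic congruences -/

/-- A linear space of polynomials (in the application: of quadratic forms). -/
abbrev PolySpace (n : ℕ) : Type := Submodule ℂ (MvPolynomial (Fin n) ℂ)

/-- The isomorphism `W₀^* ≃ W₀` induced by `σ^*` when `σ^*` is injective with image `W₀`. -/
def RationalLift.starEquiv {n : ℕ} {W₀ : PolySpace n} (F : RationalLift n W₀)
    (hinj : Function.Injective F.star) (hrange : LinearMap.range F.star = W₀) :
    Module.Dual ℂ W₀ ≃ₗ[ℂ] W₀ :=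
  (LinearEquiv.ofInjective F.star hinj).trans (LinearEquiv.ofEq _ _ hrange)

/-- The (lift of a) rational map `σ : ℙ(ℂⁿ) ⇢ ℙ(W₀)` is a quadratic congruence. -/
structure RationalLift.IsQuadraticCongruence {n : ℕ} {W₀ : PolySpace n}
    (F : RationalLift n W₀) : Prop where
  /-- `σ^*(𝒪(1)) = 𝒪(2)` -/
  degree_eq : F.degree = 2
  /-- `σ^*` induces an isomorphism `W₀^* ≃ W₀` -/
  injective : Function.Injective F.star
  range_eq : LinearMap.range F.star = W₀
  /-- `P ∈ σ(P)` for every point `P` where `σ` is defined, `σ(P)` being seen as a quadric -/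
  mem : ∀ (x : Fin n → ℂ) (w : W₀), F.MapsTo x w → eval x (w : MvPolynomial (Fin n) ℂ) = 0
  /-- the isomorphism `φ = (σ^*)⁻¹ : W₀ ≃ W₀^*` is not antisymmetric -/
  not_antisymm : ¬ ∀ u v : W₀,
    (F.starEquiv injective range_eq).symm u v = -(F.starEquiv injective range_eq).symm v u

/-- `Cong(W₀)`: the set of quadratic congruences `ℙ(ℂⁿ) ⇢ ℙ(W₀)`. -/
def Cong {n : ℕ} (W₀ : PolySpace n) : Type :=
  {σ : RationalMap n W₀ // ∃ F : RationalLift n W₀,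
    (Quotient.mk _ F : RationalMap n W₀) = σ ∧ F.IsQuadraticCongruence}

/-! ### The orbit space `Isom(W₀, W₀^*) / GL(W₀)` -/

/-- `Isom(W, W^*)`, with the right action `φ · g = ᵗg ∘ φ ∘ g` of `GL(W)`. -/
abbrev Isom (W : Type*) [AddCommGroup W] [Module ℂ W] : Type _ := W ≃ₗ[ℂ] Module.Dual ℂ W

def Isom.act {W : Type*} [AddCommGroup W] [Module ℂ W] (φ : Isom W) (g : W ≃ₗ[ℂ] W) : Isom W :=
  (g.trans φ).trans g.dualMap

theorem Isom.act_apply {W : Type*} [AddCommGroup W] [Module ℂ W] (φ : Isom W) (g : W ≃ₗ[ℂ] W)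
    (u v : W) : φ.act g u v = φ (g u) (g v) := rfl

/-- `φ'` is in the `GL(W)`-orbit of `φ`. -/
instance isomSetoid (W : Type*) [AddCommGroup W] [Module ℂ W] : Setoid (Isom W) where
  r φ φ' := ∃ g : W ≃ₗ[ℂ] W, φ' = φ.act g
  iseqv :=
    { refl := fun φ => ⟨LinearEquiv.refl ℂ W, by ext u v; simp [Isom.act_apply]⟩
      symm := by
        rintro φ φ' ⟨g, rfl⟩
        exact ⟨g.symm, by ext u v; simp [Isom.act_apply]⟩
      trans := by
        rintro φ φ' φ'' ⟨g, rfl⟩ ⟨k, rfl⟩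
        exact ⟨k.trans g, by ext u v; simp [Isom.act_apply]⟩ }

/-- `Isom(W, W^*) / GL(W)` -/
def IsomQuot (W : Type*) [AddCommGroup W] [Module ℂ W] : Type _ := Quotient (isomSetoid W)

/-! ### The group `G_{W₀}` and its action on `Cong(W₀)` -/

/-- `G_{W₀}`: the subgroup of `GL(ℂⁿ)` of the elements which leave `W₀` invariant. -/
def stab {n : ℕ} (W₀ : PolySpace n) : Subgroup (GL (Fin n) ℂ) where
  carrier := {A | ∀ p, pullback A p ∈ W₀ ↔ p ∈ W₀}
  one_mem' := by intro p; rw [pullback_one]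
  mul_mem' := by
    intro A B hA hB p
    rw [pullback_mul, hB, hA]
  inv_mem' := by
    intro A hA p
    rw [← hA, pullback_apply_inv]

/-- The homomorphism `α ↦ α^*|_{W₀}` from (the opposite group of) `G_{W₀}` to `GL(W₀)`.  On the
level of quadrics it is `Q ↦ α⁻¹(Q)`, because `q ∘ α` is an equation of `α⁻¹({q = 0})`. -/
def restr {n : ℕ} {W₀ : PolySpace n} (A : stab W₀) : W₀ ≃ₗ[ℂ] W₀ :=
  LinearEquiv.ofSubmodules (pullback (A : GL (Fin n) ℂ)).toLinearEquiv W₀ W₀ (by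
    ext p
    constructor
    · rintro ⟨q, hq, rfl⟩
      exact (A.2 q).2 hq
    · intro hp
      exact ⟨pullback (A : GL (Fin n) ℂ)⁻¹ p, ((stab W₀).inv_mem A.2 p).2 hp,
        pullback_apply_inv _ p⟩)

theorem restr_coe {n : ℕ} {W₀ : PolySpace n} (A : stab W₀) (w : W₀) :
    (restr A w : MvPolynomial (Fin n) ℂ) = pullback (A : GL (Fin n) ℂ) w := rfl

theorem restr_mul {n : ℕ} {W₀ : PolySpace n} (A B : stab W₀) (w : W₀) :
    restr (A * B) w = restr B (restr A w) :=
  Subtype.ext (by simp only [restr_coe, Subgroup.coe_mul, pullback_mul])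

theorem restr_one {n : ℕ} {W₀ : PolySpace n} (w : W₀) : restr (1 : stab W₀) w = w :=
  Subtype.ext (by simp only [restr_coe, Subgroup.coe_one, pullback_one])

/-- The rational map `α.σ : P ↦ α⁻¹(σ(α(P)))`, on lifts: `x ↦ (σ (α x)) ∘ α`, so that
`(α.σ)^* l = (σ^* (l ∘ α^*|_{W₀})) ∘ α`. -/
def RationalLift.act {n : ℕ} {W₀ : PolySpace n} (A : stab W₀) (F : RationalLift n W₀) :
    RationalLift n W₀ where
  degree := F.degree
  star := (pullback (A : GL (Fin n) ℂ)).toLinearMap ∘ₗ F.star ∘ₗ (restr A).dualMap.toLinearMap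
  homogeneous l := isHomogeneous_pullback _ (F.homogeneous _)
  coprime p hp := by
    have h : IsUnit (pullback (A : GL (Fin n) ℂ)⁻¹ p) := by
      apply F.coprime
      intro l
      have h1 := map_dvd (pullback (A : GL (Fin n) ℂ)⁻¹) (hp ((restr A).dualMap.symm l))
      simp only [LinearMap.comp_apply, AlgEquiv.toLinearMap_apply, LinearEquiv.coe_coe,
        LinearEquiv.apply_symm_apply, pullback_inv_apply] at h1
      exact h1
    have h2 := h.map (pullback (A : GL (Fin n) ℂ))
    rwa [pullback_apply_inv] at h2

theorem RationalLift.act_star {n : ℕ} {W₀ : PolySpace n} (A : stab W₀) (F : RationalLift n W₀)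
    (l : Module.Dual ℂ W₀) :
    (F.act A).star l = pullback (A : GL (Fin n) ℂ) (F.star ((restr A).dualMap l)) := rfl

/-- The lift `α.σ` sends `x` to `α^* w` if and only if `σ` sends `α x` to `w`. -/
theorem RationalLift.act_mapsTo {n : ℕ} {W₀ : PolySpace n} (A : stab W₀) (F : RationalLift n W₀)
    (x : Fin n → ℂ) (w : W₀) :
    (F.act A).MapsTo x (restr A w) ↔
      F.MapsTo ((A : GL (Fin n) ℂ).1.mulVec x) w := by
  have hx : (A : GL (Fin n) ℂ).1.mulVec x = 0 ↔ x = 0 := by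
    constructor
    · intro h
      have h1 := congrArg (((A : GL (Fin n) ℂ)⁻¹).1.mulVec) h
      rw [Matrix.mulVec_mulVec, ← Units.val_mul, inv_mul_cancel] at h1
      simpa using h1
    · rintro rfl
      simp
  unfold RationalLift.MapsTo
  refine and_congr (not_congr hx.symm) (and_congr (by simp) ?_)
  simp only [RationalLift.act_star, pullback_apply, eval_pullbackHom]
  constructor
  · intro h l
    have h1 := h ((restr A).dualMap.symm l)
    rw [LinearEquiv.apply_symm_apply] at h1
    rw [← h1]
    simp [LinearEquiv.dualMap_symm, LinearEquiv.dualMap_apply]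
  · intro h l
    exact h ((restr A).dualMap l)

theorem RationalLift.act_injective {n : ℕ} {W₀ : PolySpace n} (A : stab W₀)
    {F : RationalLift n W₀} (h : Function.Injective F.star) :
    Function.Injective (F.act A).star := by
  intro l l' hl
  exact (restr A).dualMap.injective (h ((pullback (A : GL (Fin n) ℂ)).injective hl))

theorem RationalLift.act_range {n : ℕ} {W₀ : PolySpace n} (A : stab W₀)
    {F : RationalLift n W₀} (h : LinearMap.range F.star = W₀) :
    LinearMap.range (F.act A).star = W₀ := by
  ext p
  constructor
  · rintro ⟨l, rfl⟩
    have h1 : F.star ((restr A).dualMap l) ∈ W₀ :=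
      h.le (LinearMap.mem_range_self F.star _)
    exact (A.2 _).2 h1
  · intro hp
    have h1 : pullback (A : GL (Fin n) ℂ)⁻¹ p ∈ LinearMap.range F.star :=
      h.ge (((stab W₀).inv_mem A.2 p).2 hp)
    obtain ⟨l, hl⟩ := h1
    refine ⟨(restr A).dualMap.symm l, ?_⟩
    rw [RationalLift.act_star, LinearEquiv.apply_symm_apply, hl, pullback_apply_inv]

theorem RationalLift.starEquiv_coe {n : ℕ} {W₀ : PolySpace n} (F : RationalLift n W₀)
    (hinj : Function.Injective F.star) (hrange : LinearMap.range F.star = W₀)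
    (l : Module.Dual ℂ W₀) :
    (F.starEquiv hinj hrange l : MvPolynomial (Fin n) ℂ) = F.star l := rfl

/-- Compatibility of `σ ↦ (σ^*)⁻¹` with `G_{W₀} → GL(W₀)`. -/
theorem RationalLift.starEquiv_act {n : ℕ} {W₀ : PolySpace n} (A : stab W₀)
    (F : RationalLift n W₀)
    (hinj : Function.Injective F.star) (hrange : LinearMap.range F.star = W₀) :
    ((F.act A).starEquiv (F.act_injective A hinj) (F.act_range A hrange)).symm
      = Isom.act (F.starEquiv hinj hrange).symm (restr A).symm := by
  have key : ∀ l, (F.act A).starEquiv (F.act_injective A hinj) (F.act_range A hrange) l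
      = restr A (F.starEquiv hinj hrange ((restr A).dualMap l)) := fun l => rfl
  apply LinearEquiv.ext
  intro u
  rw [LinearEquiv.symm_apply_eq, key]
  have : (restr A).dualMap (Isom.act (F.starEquiv hinj hrange).symm (restr A).symm u)
      = (F.starEquiv hinj hrange).symm ((restr A).symm u) := by
    ext v
    simp [Isom.act_apply, LinearEquiv.dualMap_apply]
  rw [this]
  simp

theorem RationalLift.IsQuadraticCongruence.act {n : ℕ} {W₀ : PolySpace n} (A : stab W₀)
    {F : RationalLift n W₀} (h : F.IsQuadraticCongruence) :
    (F.act A).IsQuadraticCongruence where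
  degree_eq := h.degree_eq
  injective := F.act_injective A h.injective
  range_eq := F.act_range A h.range_eq
  mem := by
    intro x w hw
    have h1 := h.mem ((A : GL (Fin n) ℂ).1.mulVec x) ((restr A).symm w)
      ((F.act_mapsTo A x _).1 (by rwa [LinearEquiv.apply_symm_apply]))
    rw [← eval_pullbackHom, ← pullback_apply, ← restr_coe, LinearEquiv.apply_symm_apply] at h1
    exact h1
  not_antisymm := by
    rw [RationalLift.starEquiv_act A F h.injective h.range_eq]
    intro hs
    apply h.not_antisymm
    intro u v
    have := hs (restr A u) (restr A v)
    simpa [Isom.act_apply] using this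

theorem RationalLift.act_rel {n : ℕ} {W₀ : PolySpace n} (A : stab W₀)
    (F F' : RationalLift n W₀) (h : F ≈ F') : F.act A ≈ F'.act A := by
  obtain ⟨c, hc, h⟩ := h
  refine ⟨c, hc, ?_⟩
  apply LinearMap.ext
  intro l
  rw [RationalLift.act_star, h]
  simp [RationalLift.act_star]

/-- The action `(α.σ)(P) = α⁻¹(σ(α(P)))` of `G_{W₀}` on rational maps `ℙ(ℂⁿ) ⇢ ℙ(W₀)`. -/
def RationalMap.act {n : ℕ} {W₀ : PolySpace n} (A : stab W₀) :
    RationalMap n W₀ → RationalMap n W₀ :=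
  Quotient.map (RationalLift.act A) (RationalLift.act_rel A)

/-- The action of `G_{W₀}` on `Cong(W₀)`. -/
def Cong.act {n : ℕ} {W₀ : PolySpace n} (A : stab W₀) (σ : Cong W₀) : Cong W₀ :=
  ⟨RationalMap.act A σ.1, by
    obtain ⟨_, F, rfl, hF⟩ := σ
    exact ⟨F.act A, rfl, hF.act A⟩⟩

theorem Cong.act_one {n : ℕ} {W₀ : PolySpace n} (σ : Cong W₀) : σ.act 1 = σ := by
  obtain ⟨_, F, rfl, hF⟩ := σ
  apply Subtype.ext
  apply Quotient.sound
  refine ⟨1, one_ne_zero, ?_⟩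
  apply LinearMap.ext
  intro l
  have : (restr (1 : stab W₀)).dualMap l = l := by
    ext w
    simp [LinearEquiv.dualMap_apply, restr_one]
  simp [RationalLift.act_star, this, pullback_one]

theorem Cong.act_act {n : ℕ} {W₀ : PolySpace n} (A B : stab W₀) (σ : Cong W₀) :
    (σ.act A).act B = σ.act (A * B) := by
  obtain ⟨_, F, rfl, hF⟩ := σ
  apply Subtype.ext
  apply Quotient.sound
  refine ⟨1, one_ne_zero, ?_⟩
  apply LinearMap.ext
  intro l
  have : (restr (A * B)).dualMap l = (restr A).dualMap ((restr B).dualMap l) := by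
    ext w
    simp [LinearEquiv.dualMap_apply, restr_mul]
  simp [RationalLift.act_star, this, pullback_mul]

/-- `σ'` is in the `G_{W₀}`-orbit of `σ`. -/
instance congSetoid {n : ℕ} (W₀ : PolySpace n) : Setoid (Cong W₀) where
  r σ σ' := ∃ A : stab W₀, σ' = σ.act A
  iseqv :=
    { refl := fun σ => ⟨1, σ.act_one.symm⟩
      symm := by
        rintro σ σ' ⟨A, rfl⟩
        exact ⟨A⁻¹, by rw [Cong.act_act, mul_inv_cancel, Cong.act_one]⟩
      trans := by
        rintro σ σ' σ'' ⟨A, rfl⟩ ⟨B, rfl⟩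
        exact ⟨A * B, by rw [Cong.act_act]⟩ }

/-- `Cong(W₀) / G_{W₀}` -/
def CongQuot {n : ℕ} (W₀ : PolySpace n) : Type := Quotient (congSetoid W₀)

/-! ### The quotient map -/

/-- The isomorphism `φ = (σ^*)⁻¹ : W₀ ≃ W₀^*` associated with a lift of a congruence. -/
def RationalLift.phi {n : ℕ} {W₀ : PolySpace n} (F : RationalLift n W₀)
    (h : F.IsQuadraticCongruence) : Isom W₀ :=
  (F.starEquiv h.injective h.range_eq).symm

/-- Proportional lifts have proportional `φ`, hence (over `ℂ`) in the same `GL(W₀)`-orbit. -/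
theorem RationalLift.phi_rel {n : ℕ} {W₀ : PolySpace n} {F F' : RationalLift n W₀}
    (h : F.IsQuadraticCongruence) (h' : F'.IsQuadraticCongruence) (hFF' : F ≈ F') :
    F.phi h ≈ F'.phi h' := by
  obtain ⟨c, hc, hs⟩ := hFF'
  obtain ⟨r, hr⟩ := IsAlgClosed.exists_pow_nat_eq c⁻¹ (n := 2) (by norm_num)
  have hr0 : r ≠ 0 := by
    rintro rfl
    exact inv_ne_zero hc (by simpa using hr.symm)
  refine ⟨LinearEquiv.smulOfNeZero ℂ W₀ r hr0, ?_⟩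
  apply LinearEquiv.ext
  intro u
  have hact : Isom.act (F.phi h) (LinearEquiv.smulOfNeZero ℂ W₀ r hr0) u
      = c⁻¹ • F.phi h u := by
    ext v
    rw [Isom.act_apply, ← hr]
    simp [pow_two, mul_assoc]
  rw [hact]
  unfold RationalLift.phi
  rw [LinearEquiv.symm_apply_eq]
  apply Subtype.ext
  rw [RationalLift.starEquiv_coe, hs, LinearMap.smul_apply, map_smul, smul_smul,
    mul_inv_cancel₀ hc, one_smul, ← RationalLift.starEquiv_coe F h.injective h.range_eq,
    LinearEquiv.apply_symm_apply]

/-- The map `Cong(W₀) → Isom(W₀, W₀^*) / GL(W₀)`, `σ ↦ [(σ^*)⁻¹]`.  The isomorphism `(σ^*)⁻¹`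
is defined up to a nonzero scalar, and its class does not depend on that scalar. -/
def Cong.phiClass {n : ℕ} {W₀ : PolySpace n} (σ : Cong W₀) : IsomQuot W₀ :=
  Quotient.mk _ (σ.2.choose.phi σ.2.choose_spec.2)

theorem Cong.phiClass_mk {n : ℕ} {W₀ : PolySpace n} (σ : Cong W₀) (F : RationalLift n W₀)
    (hσ : (Quotient.mk _ F : RationalMap n W₀) = σ.1) (h : F.IsQuadraticCongruence) :
    σ.phiClass = (Quotient.mk _ (F.phi h) : IsomQuot W₀) :=
  Quotient.sound (RationalLift.phi_rel _ h
    (Quotient.exact (σ.2.choose_spec.1.trans hσ.symm)))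

/-- The quotient map `Cong(W₀) / G_{W₀} → Isom(W₀, W₀^*) / GL(W₀)` induced by
`σ ↦ (σ^*)⁻¹`. -/
def quotientMap {n : ℕ} (W₀ : PolySpace n) : CongQuot W₀ → IsomQuot W₀ :=
  Quotient.lift Cong.phiClass (by
    rintro ⟨_, F, rfl, hF⟩ σ' ⟨A, rfl⟩
    have h1 := Cong.phiClass_mk ⟨(Quotient.mk _ F : RationalMap n W₀), F, rfl, hF⟩ F rfl hF
    have h2 := Cong.phiClass_mk (Cong.act A ⟨(Quotient.mk _ F : RationalMap n W₀), F, rfl, hF⟩)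
      (F.act A) rfl (hF.act A)
    rw [h1, h2]
    exact Quotient.sound ⟨(restr A).symm,
      RationalLift.starEquiv_act A F hF.injective hF.range_eq⟩)

/-! ### Quadrics of a hyperplane -/

/-- A quadric `C` of a hyperplane of `ℙ(ℂⁿ)`: the subscheme with equations `h = q = 0`, where `h`
is a nonzero linear form and `q` is a quadratic form which does not vanish identically on the
hyperplane `h = 0`.  For `n = 3` these are the pairs of distinct points and the double points on
a line of `ℙ₂`. -/
structure HyperplaneQuadric (n : ℕ) where
  /-- equation of the hyperplane -/
  h : MvPolynomial (Fin n) ℂ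
  /-- equation of the quadric in the hyperplane -/
  q : MvPolynomial (Fin n) ℂ
  h_homogeneous : h.IsHomogeneous 1
  h_ne_zero : h ≠ 0
  q_homogeneous : q.IsHomogeneous 2
  not_dvd : ¬ h ∣ q

/-- The space `W₀` of equations of quadrics of `ℙ(ℂⁿ)` containing (the scheme) `C`: the quadratic
forms in the homogeneous ideal of `C`. -/
def HyperplaneQuadric.W {n : ℕ} (C : HyperplaneQuadric n) : PolySpace n :=
  homogeneousSubmodule (Fin n) ℂ 2 ⊓ (Ideal.span {C.h, C.q}).restrictScalars ℂ

end

end QuadCong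

/-! In a basis of `W₀`, the map `σ^*` is an invertible 4×4 matrix `S`, that is a tensor in `W₀ ⊗
W₀`, known up to a nonzero scalar. Both `GL(W₀)` and `G_C` act on it by congruences `S ↦ K S ᵗK`.
Hence the ratios `det (S + a ᵗS) / det S` are constant on a fiber (`HasMatrix.exists_invariant`),
while `S` determines the class in `Cong(C)/G_C` (`HasMatrix.unique`). It suffices to reduce `S`, by
coordinate changes preserving `C`, to a shape for which these ratios leave finitely many
possibilities (`finite_of_normalForms`).

The condition `P ∈ σ(P)` says that the symmetric part of `S` is a quadratic relation between the
conics of `W₀`. For the basis `z², zx, zy, q` with `q = xy` or `q = y²`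
(`HyperplaneQuadric.exists_basis`) there is only one relation up to a scalar: `z²·xy = zx·zy`, resp.
`z²·y² = (zy)²`. Since `S` is not antisymmetric, this part can be scaled to a fixed tensor; the
antisymmetric part, with six parameters, is free.

Two points: `W₀ = ⟨z,x⟩ ⊗ ⟨z,y⟩`, so `Λ²W₀` is a space of pairs `(u, v)` of binary quadratic forms.
The substitutions `x ↦ bx + cz` act on `u` alone, and `y ↦ by + cz` on `v` alone. Forms of given
discriminant fall into finitely many orbits under such triangular substitutions, and the ratios for
`a = ±1` give the sum and the squared difference of the two discriminants.

Double point: the antisymmetric part consists of a bivector `(a, b, c)` on `⟨z², zy, y²⟩` and a form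
`(u, v, w)` pairing `zx` with these three conics. Coordinate changes leave at most one continuous
parameter, and the ratio for `a = -1` restricts it to finitely many values. -/

namespace QuadCong

noncomputable section

/-! ### The matrix of a congruence -/

section Tensor

variable {ι W : Type*} [Fintype ι] [DecidableEq ι] [AddCommGroup W] [Module ℂ W]

/-- The matrix of a map `s : W^* → W`, seen as an element of `W ⊗ W`, in a basis of `W`. -/
def tensorMatrix (e : Module.Basis ι ℂ W) (s : Module.Dual ℂ W →ₗ[ℂ] W) : Matrix ι ι ℂ :=
  LinearMap.toMatrix e.dualBasis e s

theorem tensorMatrix_apply (e : Module.Basis ι ℂ W) (s : Module.Dual ℂ W →ₗ[ℂ] W) (i j : ι) :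
    tensorMatrix e s i j = e.repr (s (e.coord j)) i := by
  simp [tensorMatrix, LinearMap.toMatrix_apply]

/-- In dual bases `ᵗg` has the transposed matrix, so a linear map acts on tensors by a congruence.
-/
theorem tensorMatrix_conj (e : Module.Basis ι ℂ W) (s s' : Module.Dual ℂ W →ₗ[ℂ] W)
    (g : W →ₗ[ℂ] W) (h : ∀ l, s' l = g (s (g.dualMap l))) :
    tensorMatrix e s' = LinearMap.toMatrix e e g * tensorMatrix e s *
      (LinearMap.toMatrix e e g).transpose := by
  have h' : s' = g ∘ₗ s ∘ₗ g.dualMap := LinearMap.ext h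
  rw [h', tensorMatrix, LinearMap.toMatrix_comp _ e, LinearMap.toMatrix_comp _ e.dualBasis,
    tensorMatrix, mul_assoc, ← LinearMap.toMatrix_transpose]
  rfl

theorem det_tensorMatrix_ne_zero (e : Module.Basis ι ℂ W) (s : Module.Dual ℂ W ≃ₗ[ℂ] W) :
    (tensorMatrix e s.toLinearMap).det ≠ 0 :=
  (LinearEquiv.isUnit_det s e.dualBasis e).ne_zero

theorem apply_eq_sum_tensorMatrix (e : Module.Basis ι ℂ W) (s : Module.Dual ℂ W →ₗ[ℂ] W)
    (l m : Module.Dual ℂ W) :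
    l (s m) = ∑ i, ∑ j, tensorMatrix e s i j * (l (e i) * m (e j)) := by
  have hm : m = ∑ j, m (e j) • e.coord j := by
    apply e.ext
    intro k
    simp
  conv_lhs => rw [hm, map_sum, map_sum]
  rw [Finset.sum_comm]
  refine Finset.sum_congr rfl fun j _ => ?_
  rw [map_smul, map_smul]
  conv_lhs => rw [← e.sum_repr (s (e.coord j)), map_sum, Finset.smul_sum]
  refine Finset.sum_congr rfl fun i _ => ?_
  rw [tensorMatrix_apply, map_smul, smul_eq_mul, smul_eq_mul]
  ring

end Tensor

variable {n : ℕ} {W₀ : PolySpace n}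

/-- The matrix of `σ^* : W₀^* ≃ W₀` in a basis of `W₀`. -/
def RationalLift.matrix {ι : Type*} [Fintype ι] [DecidableEq ι] (e : Module.Basis ι ℂ W₀)
    (F : RationalLift n W₀) (h : F.IsQuadraticCongruence) : Matrix ι ι ℂ :=
  tensorMatrix e (F.starEquiv h.injective h.range_eq).toLinearMap

/-- The congruence with a given lift. -/
def RationalLift.IsQuadraticCongruence.cong {F : RationalLift n W₀}
    (h : F.IsQuadraticCongruence) : Cong W₀ :=
  ⟨Quotient.mk _ F, F, rfl, h⟩

/-! ### Congruence classes and their matrices -/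

section

variable {ι : Type*} [Fintype ι] [DecidableEq ι] (e : Module.Basis ι ℂ W₀)

theorem RationalLift.rel_of_matrix {F F' : RationalLift n W₀} (h : F.IsQuadraticCongruence)
    (h' : F'.IsQuadraticCongruence) {c : ℂ} (hc : c ≠ 0)
    (hm : F'.matrix e h' = c • F.matrix e h) : F ≈ F' := by
  refine ⟨c, hc, ?_⟩
  have : (F'.starEquiv h'.injective h'.range_eq).toLinearMap
      = c • (F.starEquiv h.injective h.range_eq).toLinearMap := by
    apply (LinearMap.toMatrix e.dualBasis e).injective
    rw [map_smul]
    exact hm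
  apply LinearMap.ext
  intro l
  exact congrArg Subtype.val (LinearMap.congr_fun this l)

theorem RationalLift.matrix_act {F : RationalLift n W₀} (h : F.IsQuadraticCongruence)
    (A : stab W₀) :
    (F.act A).matrix e (h.act A) = LinearMap.toMatrix e e (restr A).toLinearMap * F.matrix e h *
      (LinearMap.toMatrix e e (restr A).toLinearMap).transpose :=
  tensorMatrix_conj e _ _ _ fun _ => rfl

theorem RationalLift.exists_conj_of_phi {F F' : RationalLift n W₀} (h : F.IsQuadraticCongruence)
    (h' : F'.IsQuadraticCongruence) (hr : F.phi h ≈ F'.phi h') :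
    ∃ K : Matrix ι ι ℂ, K.det ≠ 0 ∧ F'.matrix e h' = K * F.matrix e h * K.transpose := by
  obtain ⟨g, hg⟩ := hr
  -- Inverting `φ' = ᵗg ∘ φ ∘ g` gives `s' = g⁻¹ ∘ s ∘ ᵗg⁻¹`, hence the inverse of `g`.
  refine ⟨LinearMap.toMatrix e e g.symm.toLinearMap,
    (LinearEquiv.isUnit_det g.symm e e).ne_zero, tensorMatrix_conj e _ _ _ fun l => ?_⟩
  have key : (F'.phi h') (g.symm (F.starEquiv h.injective h.range_eq (g.symm.dualMap l))) = l := by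
    rw [hg]
    ext v
    rw [Isom.act_apply, LinearEquiv.apply_symm_apply]
    simp [RationalLift.phi, LinearEquiv.dualMap_apply]
  exact ((LinearEquiv.symm_apply_eq _).1 key).symm

/-- The matrix `S` is, up to a scalar, the matrix of a congruence in the class `c`. -/
def HasMatrix (c : CongQuot W₀) (S : Matrix ι ι ℂ) : Prop :=
  ∃ (F : RationalLift n W₀) (h : F.IsQuadraticCongruence),
    c = Quotient.mk _ h.cong ∧ ∃ k : ℂ, k ≠ 0 ∧ S = k • F.matrix e h

/-- The matrix determines `σ^*` up to a scalar, and proportional lifts are the same rational map.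
Thus counting classes reduces to counting matrices. -/
theorem HasMatrix.unique {c c' : CongQuot W₀} {S : Matrix ι ι ℂ} (h : HasMatrix e c S)
    (h' : HasMatrix e c' S) : c = c' := by
  obtain ⟨F, hF, rfl, k, hk, rfl⟩ := h
  obtain ⟨F', hF', rfl, k', hk', hS⟩ := h'
  have : hF.cong = hF'.cong := by
    apply Subtype.ext
    apply Quotient.sound
    refine RationalLift.rel_of_matrix e hF hF' (mul_ne_zero (inv_ne_zero hk') hk) ?_
    rw [mul_smul, hS, smul_smul, inv_mul_cancel₀ hk', one_smul]
  rw [this]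

theorem HasMatrix.smul {c : CongQuot W₀} {S : Matrix ι ι ℂ} (h : HasMatrix e c S) {k : ℂ}
    (hk : k ≠ 0) : HasMatrix e c (k • S) := by
  obtain ⟨F, hF, rfl, k', hk', rfl⟩ := h
  exact ⟨F, hF, rfl, k * k', mul_ne_zero hk hk', by rw [smul_smul]⟩

theorem HasMatrix.act {c : CongQuot W₀} {S : Matrix ι ι ℂ} (h : HasMatrix e c S) (A : stab W₀) :
    HasMatrix e c (LinearMap.toMatrix e e (restr A).toLinearMap * S *
      (LinearMap.toMatrix e e (restr A).toLinearMap).transpose) := by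
  obtain ⟨F, hF, rfl, k, hk, rfl⟩ := h
  refine ⟨F.act A, hF.act A, Quotient.sound ⟨A, rfl⟩, k, hk, ?_⟩
  rw [RationalLift.matrix_act e hF]
  simp

/-! ### Invariants of a fiber and reduction to normal forms -/

theorem det_conj_add (K S : Matrix ι ι ℂ) (a : ℂ) :
    ((K * S * K.transpose) + a • (K * S * K.transpose).transpose).det
      = K.det ^ 2 * (S + a • S.transpose).det := by
  have : (K * S * K.transpose) + a • (K * S * K.transpose).transpose
      = K * (S + a • S.transpose) * K.transpose := by
    simp only [Matrix.transpose_mul, Matrix.transpose_transpose, Matrix.mul_add, Matrix.add_mul,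
      Matrix.mul_smul, Matrix.smul_mul, mul_assoc]
  rw [this, Matrix.det_mul, Matrix.det_mul, Matrix.det_transpose]
  ring

/-- The classes in a fiber of the quotient map have matrices with the same value of the
invariants `det (S + a ᵗS) / det S`. -/
theorem HasMatrix.exists_invariant (y : IsomQuot W₀) (a : ℂ) :
    ∃ r : ℂ, ∀ c : CongQuot W₀, quotientMap W₀ c = y → ∀ S : Matrix ι ι ℂ, HasMatrix e c S →
      (S + a • S.transpose).det = r * S.det := by
  by_cases hy : ∃ c₀ S₀, quotientMap W₀ c₀ = y ∧ HasMatrix e c₀ S₀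
  · obtain ⟨c₀, S₀, hc₀, F, hF, rfl, k, hk, rfl⟩ := hy
    have hd : (F.matrix e hF).det ≠ 0 := det_tensorMatrix_ne_zero e _
    refine ⟨(F.matrix e hF + a • (F.matrix e hF).transpose).det / (F.matrix e hF).det, ?_⟩
    rintro c hc S ⟨F', hF', rfl, k', hk', rfl⟩
    have hrel : F.phi hF ≈ F'.phi hF' := by
      have h1 : quotientMap W₀ (Quotient.mk _ hF.cong) = Quotient.mk _ (F.phi hF) :=
        Cong.phiClass_mk _ F rfl hF
      have h2 : quotientMap W₀ (Quotient.mk _ hF'.cong) = Quotient.mk _ (F'.phi hF') :=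
        Cong.phiClass_mk _ F' rfl hF'
      exact Quotient.exact (h1.symm.trans (hc₀.trans (hc.symm.trans h2)))
    obtain ⟨K, -, hK⟩ := RationalLift.exists_conj_of_phi e hF hF' hrel
    have h3 : k' • F'.matrix e hF' + a • (k' • F'.matrix e hF').transpose
        = k' • (F'.matrix e hF' + a • (F'.matrix e hF').transpose) := by
      rw [Matrix.transpose_smul, smul_add, smul_comm a k']
    rw [h3, Matrix.det_smul, Matrix.det_smul, hK, det_conj_add, Matrix.det_mul, Matrix.det_mul,
      Matrix.det_transpose]
    field_simp
  -- No class of the fiber has a matrix, so any ratio will do.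
  · push Not at hy
    exact ⟨0, fun c hc S hS => absurd hS (hy c S hc)⟩

theorem HasMatrix.det_ne_zero {c : CongQuot W₀} {S : Matrix ι ι ℂ} (h : HasMatrix e c S) :
    S.det ≠ 0 := by
  obtain ⟨F, hF, rfl, k, hk, rfl⟩ := h
  rw [Matrix.det_smul]
  exact mul_ne_zero (pow_ne_zero _ hk) (det_tensorMatrix_ne_zero e _)

theorem exists_hasMatrix (c : CongQuot W₀) :
    ∃ (F : RationalLift n W₀) (h : F.IsQuadraticCongruence), HasMatrix e c (F.matrix e h) := by
  obtain ⟨⟨_, F, rfl, hF⟩, rfl⟩ := Quotient.exists_rep c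
  exact ⟨F, hF, F, hF, rfl, 1, one_ne_zero, by rw [one_smul]⟩

/-- A fiber is finite if all its classes have a matrix in a finite set of normal forms. -/
theorem finite_of_normalForms (T : Set (CongQuot W₀)) (N : Set (Matrix ι ι ℂ)) (hN : N.Finite)
    (h : ∀ c ∈ T, ∃ S ∈ N, HasMatrix e c S) : T.Finite := by
  choose! f hf using h
  refine Set.Finite.of_injOn (f := f) (fun c hc => (hf c hc).1) ?_ hN
  intro c hc c' hc' hcc
  exact (hf c hc).2.unique e (hcc ▸ (hf c' hc').2)

/-- The condition `P ∈ σ(P)`, on matrices. -/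
theorem RationalLift.IsQuadraticCongruence.sum_matrix {F : RationalLift n W₀}
    (h : F.IsQuadraticCongruence) (x : Fin n → ℂ) :
    ∑ i, ∑ j, F.matrix e h i j * (eval x (e i : MvPolynomial (Fin n) ℂ) *
      eval x (e j : MvPolynomial (Fin n) ℂ)) = 0 := by
  let ev : Module.Dual ℂ W₀ :=
    (MvPolynomial.aeval x : MvPolynomial (Fin n) ℂ →ₐ[ℂ] ℂ).toLinearMap ∘ₗ W₀.subtype
  have hev : ∀ w : W₀, ev w = eval x (w : MvPolynomial (Fin n) ℂ) := fun w => by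
    simp [ev, MvPolynomial.aeval_eq_eval]
  let s := F.starEquiv h.injective h.range_eq
  have hsum := apply_eq_sum_tensorMatrix e s.toLinearMap
  -- The value of the lift at `x`. Evaluating the conic `w` at `x` gives the double sum, by `hw`
  -- applied to the functional `ev` itself.
  let w : W₀ := ∑ j, eval x (F.star (e.coord j)) • e j
  have hw : ∀ l, l w = ev (s l) := by
    intro l
    have hl : l = ∑ j, l (e j) • e.coord j := by
      apply e.ext
      intro k
      simp
    conv_rhs => rw [hl, map_sum, map_sum]
    simp only [w, map_sum, map_smul]
    refine Finset.sum_congr rfl fun j _ => ?_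
    rw [smul_eq_mul, smul_eq_mul, mul_comm, hev]
    rfl
  have hsw := hsum ev ev
  simp only [hev] at hsw
  refine hsw.symm.trans ?_
  change eval x (s ev : MvPolynomial (Fin n) ℂ) = 0
  rw [← hev, ← hw, hev]
  by_cases hw0 : w = 0
  · simp [hw0]
  by_cases hx : x = 0
  -- Forms of degree 2 vanish at the origin, which would force `w = 0`.
  · exfalso
    apply hw0
    refine Finset.sum_eq_zero fun j _ => ?_
    have h2 := (F.homogeneous (e.coord j))
    rw [h.degree_eq] at h2
    have : eval x (F.star (e.coord j)) = 0 := by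
      rw [hx, MvPolynomial.eval_zero, constantCoeff_eq]
      exact h2.coeff_eq_zero (by simp)
    rw [this, zero_smul]
  · exact h.mem x w ⟨hx, hw0, fun l => by rw [hw, hev]; rfl⟩

/-- Antisymmetry passes from a tensor to the inverse bilinear form: substitute `l = φ u`, `m = φ v`
in `l (s m) = -m (s l)`. -/
theorem RationalLift.IsQuadraticCongruence.matrix_not_antisymm {F : RationalLift n W₀}
    (h : F.IsQuadraticCongruence) : (F.matrix e h) + (F.matrix e h).transpose ≠ 0 := by
  intro h0
  apply h.not_antisymm
  let s := F.starEquiv h.injective h.range_eq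
  have hsum := apply_eq_sum_tensorMatrix e s.toLinearMap
  have key : ∀ l m : Module.Dual ℂ W₀, l (s m) = - m (s l) := by
    intro l m
    have h1 := hsum l m
    have h2 := hsum m l
    rw [Finset.sum_comm] at h2
    have h3 : l (s m) + m (s l) = 0 := by
      change l (s.toLinearMap m) + m (s.toLinearMap l) = 0
      rw [h1, h2, ← Finset.sum_add_distrib]
      refine Finset.sum_eq_zero fun i _ => ?_
      rw [← Finset.sum_add_distrib]
      refine Finset.sum_eq_zero fun j _ => ?_
      have h4 := congrFun (congrFun h0 i) j
      simp only [Matrix.add_apply, Matrix.transpose_apply, Matrix.zero_apply] at h4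
      change (F.matrix e h i j) * _ + (F.matrix e h j i) * _ = 0
      linear_combination (l (e i) * m (e j)) * h4
    linear_combination h3
  intro u v
  have := key (s.symm u) (s.symm v)
  simpa using this

end

/-! ### Coordinate changes preserving the space of equations -/

theorem mem_stab_of_le [FiniteDimensional ℂ W₀] (A : GL (Fin n) ℂ)
    (h : ∀ p ∈ W₀, pullback A p ∈ W₀) : A ∈ stab W₀ := by
  have hle : W₀.map (pullback A).toLinearEquiv.toLinearMap ≤ W₀ := by
    rintro _ ⟨p, hp, rfl⟩
    exact h p hp
  have heq := Submodule.eq_of_le_of_finrank_eq hle (LinearEquiv.finrank_map_eq _ _)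
  intro p
  refine ⟨fun hp => ?_, h p⟩
  rw [← heq] at hp
  obtain ⟨p', hp', hpp⟩ := hp
  rwa [← (pullback A).injective hpp]

/-- The expansion of the pulled-back basis vectors already shows that `A` preserves `W₀`, and its
coefficients are the matrix of `restr A`; no separate check of stability is needed later. -/
theorem HasMatrix.conj {ι : Type*} [Fintype ι] [DecidableEq ι] (e : Module.Basis ι ℂ W₀)
    {c : CongQuot W₀} {S : Matrix ι ι ℂ} (h : HasMatrix e c S) (A : GL (Fin n) ℂ)
    (P : Matrix ι ι ℂ)
    (hP : ∀ j, pullback A (e j : MvPolynomial (Fin n) ℂ) = ∑ i, P i j • (e i : MvPolynomial _ ℂ)) :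
    HasMatrix e c (P * S * P.transpose) := by
  have : FiniteDimensional ℂ W₀ := e.finiteDimensional_of_finite
  have hA : A ∈ stab W₀ := by
    refine mem_stab_of_le A fun p hp => ?_
    have h1 : p = ∑ j, e.repr ⟨p, hp⟩ j • (e j : MvPolynomial _ ℂ) := by
      have h2 := congrArg Subtype.val (e.sum_repr ⟨p, hp⟩)
      rw [AddSubmonoidClass.coe_finsetSum] at h2
      exact h2.symm
    rw [h1, map_sum]
    refine W₀.sum_mem fun j _ => ?_
    rw [map_smul, hP]
    exact W₀.smul_mem _ (W₀.sum_mem fun i _ => W₀.smul_mem _ (e i).2)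
  have hPA : LinearMap.toMatrix e e (restr ⟨A, hA⟩).toLinearMap = P := by
    rw [← LinearEquiv.eq_symm_apply]
    apply e.ext
    intro j
    apply Subtype.ext
    rw [LinearMap.toMatrix_symm, Matrix.toLin_self]
    simpa [restr_coe] using hP j
  rw [← hPA]
  exact h.act e ⟨A, hA⟩

/-! ### Normal form of the space of equations -/

theorem homogeneousComponent_mul_right {σ : Type*} {p q : MvPolynomial σ ℂ} {i j : ℕ}
    (hq : q.IsHomogeneous i) :
    homogeneousComponent (j + i) (p * q) = homogeneousComponent j p * q := by
  let _ := MvPolynomial.gradedAlgebra (σ := σ) (R := ℂ)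
  have h := DirectSum.coe_decompose_mul_of_right_mem_of_le (homogeneousSubmodule σ ℂ) (a := p)
    (b := q) (i := i) (n := j + i) hq (Nat.le_add_left _ _)
  rw [Nat.add_sub_cancel] at h
  rw [← decomposition.decompose'_apply, ← decomposition.decompose'_apply]
  exact h

/-- The degree 2 component of `a h + b q` only involves the linear part of `a` and the constant term
of `b`. -/
theorem HyperplaneQuadric.mem_W_iff {n : ℕ} (C : HyperplaneQuadric n)
    (p : MvPolynomial (Fin n) ℂ) :
    p ∈ C.W ↔ ∃ (l : MvPolynomial (Fin n) ℂ) (c : ℂ), l.IsHomogeneous 1 ∧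
      p = l * C.h + c • C.q := by
  constructor
  · rintro ⟨hp, hI⟩
    obtain ⟨a, b, hab⟩ := Ideal.mem_span_pair.1 hI
    refine ⟨homogeneousComponent 1 a, coeff 0 b, homogeneousComponent_isHomogeneous _ _, ?_⟩
    rw [← homogeneousComponent_eq_self hp, ← hab, map_add,
      homogeneousComponent_mul_right (j := 1) C.h_homogeneous,
      homogeneousComponent_mul_right (j := 0) C.q_homogeneous, homogeneousComponent_zero,
      smul_eq_C_mul]
  · rintro ⟨l, c, hl, rfl⟩
    refine ⟨?_, Ideal.mem_span_pair.2 ⟨l, MvPolynomial.C c, by rw [smul_eq_C_mul]⟩⟩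
    exact Submodule.add_mem _ (hl.mul C.h_homogeneous) (Submodule.smul_mem _ c C.q_homogeneous)

theorem exists_eq_of_isHomogeneous_one {p : MvPolynomial (Fin 3) ℂ} (hp : p.IsHomogeneous 1) :
    ∃ a b c : ℂ, p = a • X 0 + b • X 1 + c • X 2 := by
  have h : p ∈ homogeneousSubmodule (Fin 3) ℂ 1 := hp
  rw [homogeneousSubmodule_one_eq_span_X, Submodule.mem_span_range_iff_exists_fun] at h
  obtain ⟨f, rfl⟩ := h
  exact ⟨f 0, f 1, f 2, by rw [Fin.sum_univ_three]⟩

theorem exists_eq_of_isHomogeneous_two {p : MvPolynomial (Fin 3) ℂ} (hp : p.IsHomogeneous 2) :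
    ∃ (l : MvPolynomial (Fin 3) ℂ) (a b c : ℂ), l.IsHomogeneous 1 ∧
      p = l * X 0 + (a • X 1 ^ 2 + b • (X 1 * X 2) + c • X 2 ^ 2) := by
  have h : p ∈ homogeneousSubmodule (Fin 3) ℂ 2 := hp
  rw [← homogeneousSubmodule_one_pow, pow_two] at h
  induction h using Submodule.mul_induction_on' with
  | mem_mul_mem p hp1 q hq1 =>
    clear hp
    have hp : p.IsHomogeneous 1 := hp1
    have hq : q.IsHomogeneous 1 := hq1
    obtain ⟨a, b, c, rfl⟩ := exists_eq_of_isHomogeneous_one hp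
    obtain ⟨a', b', c', rfl⟩ := exists_eq_of_isHomogeneous_one hq
    refine ⟨a • (a' • X 0 + b' • X 1 + c' • X 2) + a' • (b • X 1 + c • X 2), b * b',
      b * c' + c * b', c * c', ?_, ?_⟩
    · have hX : ∀ i, X i ∈ homogeneousSubmodule (Fin 3) ℂ 1 := fun i => isHomogeneous_X ℂ i
      exact Submodule.add_mem _ (Submodule.smul_mem _ _ hq) (Submodule.smul_mem _ _
        (Submodule.add_mem _ (Submodule.smul_mem _ _ (hX 1)) (Submodule.smul_mem _ _ (hX 2))))
    · simp only [smul_eq_C_mul, map_add, map_mul]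
      ring
  | add p _ q _ hp' hq' =>
    rename_i hp1 hq1
    have e1 : p.IsHomogeneous 2 := by
      rw [← pow_two, homogeneousSubmodule_one_pow] at hp1; exact hp1
    have e2 : q.IsHomogeneous 2 := by
      rw [← pow_two, homogeneousSubmodule_one_pow] at hq1; exact hq1
    obtain ⟨l, a, b, c, hl, h1⟩ := hp' e1
    obtain ⟨l', a', b', c', hl', h2⟩ := hq' e2
    refine ⟨l + l', a + a', b + b', c + c', hl.add hl', ?_⟩
    rw [h1, h2, add_mul]
    module

/-- A nonzero binary quadratic form over `ℂ` has either two independent linear factors or a double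
one. In the second case `p`, `q` only complete the factor `r`, `s` to a basis, so that both cases
give a change of coordinates. -/
theorem exists_linear_factors (a b c : ℂ) (h : ¬ (a = 0 ∧ b = 0 ∧ c = 0)) :
    ∃ p q r s : ℂ, p * s - q * r ≠ 0 ∧
      ((a = p * r ∧ b = p * s + q * r ∧ c = q * s) ∨
        (a = r ^ 2 ∧ b = 2 * r * s ∧ c = s ^ 2)) := by
  by_cases ha : a = 0
  · subst ha
    by_cases hb : b = 0
    · subst hb
      have hc : c ≠ 0 := by tauto
      obtain ⟨s, hs⟩ := IsAlgClosed.exists_pow_nat_eq c (n := 2) (by norm_num)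
      refine ⟨1, 0, 0, s, ?_, Or.inr ⟨by simp, by simp, hs.symm⟩⟩
      rintro h0
      apply hc
      have : s = 0 := by linear_combination h0
      rw [← hs, this]; simp
    · exact ⟨b, c, 0, 1, by simpa using hb, Or.inl ⟨by simp, by simp, by simp⟩⟩
  · obtain ⟨d, hd⟩ := IsAlgClosed.exists_pow_nat_eq (b ^ 2 - 4 * a * c) (n := 2) (by norm_num)
    by_cases hd0 : d = 0
    · subst hd0
      obtain ⟨r, hr⟩ := IsAlgClosed.exists_pow_nat_eq a (n := 2) (by norm_num)
      have hr0 : r ≠ 0 := by rintro rfl; apply ha; rw [← hr]; simp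
      refine ⟨0, 1, r, b / (2 * r), by simpa using hr0, Or.inr ⟨hr.symm, by field_simp, ?_⟩⟩
      field_simp
      rw [hr]
      linear_combination hd
    · refine ⟨a, (b + d) / 2, 1, (b - d) / (2 * a), ?_, Or.inl ⟨by simp, ?_, ?_⟩⟩
      · have : a * ((b - d) / (2 * a)) - (b + d) / 2 * 1 = -d := by field_simp; ring
        rw [this]; exact neg_ne_zero.2 hd0
      · field_simp; ring
      · field_simp; linear_combination hd

theorem pullback_X {n : ℕ} (A : GL (Fin n) ℂ) (i : Fin n) :
    pullback A (X i) = ∑ j, (A : Matrix (Fin n) (Fin n) ℂ) i j • X j := by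
  simp [pullback_apply, pullbackHom, smul_eq_C_mul]

theorem exists_pullback_X_zero {h : MvPolynomial (Fin 3) ℂ} (hh : h.IsHomogeneous 1)
    (h0 : h ≠ 0) : ∃ M : GL (Fin 3) ℂ, pullback M (X 0) = h := by
  obtain ⟨a, b, c, rfl⟩ := exists_eq_of_isHomogeneous_one hh
  have key : ∀ N : Matrix (Fin 3) (Fin 3) ℂ, N 0 0 = a → N 0 1 = b → N 0 2 = c → N.det ≠ 0 →
      ∃ M : GL (Fin 3) ℂ, pullback M (X 0) = a • X 0 + b • X 1 + c • X 2 := by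
    rintro N rfl rfl rfl hN
    refine ⟨Matrix.GeneralLinearGroup.mkOfDetNeZero N hN, ?_⟩
    rw [pullback_X, Fin.sum_univ_three]
    rfl
  by_cases ha : a = 0
  · by_cases hb : b = 0
    · by_cases hc : c = 0
      · simp [ha, hb, hc] at h0
      · exact key !![a, b, c; 1, 0, 0; 0, 1, 0] rfl rfl rfl (by simpa [Matrix.det_fin_three])
    · exact key !![a, b, c; 1, 0, 0; 0, 0, 1] rfl rfl rfl (by simpa [Matrix.det_fin_three])
  · exact key !![a, b, c; 0, 1, 0; 0, 0, 1] rfl rfl rfl (by simpa [Matrix.det_fin_three])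

/-- Generators of the space of equations, where `q` is an equation of the quadric. -/
def gens (q : MvPolynomial (Fin 3) ℂ) : Fin 4 → MvPolynomial (Fin 3) ℂ :=
  ![X 0 ^ 2, X 0 * X 1, X 0 * X 2, q]

theorem HyperplaneQuadric.exists_W_eq_span (C : HyperplaneQuadric 3) :
    ∃ (M : GL (Fin 3) ℂ) (q : MvPolynomial (Fin 3) ℂ), (q = X 1 * X 2 ∨ q = X 2 ^ 2) ∧
      C.W = Submodule.span ℂ (Set.range fun i => pullback M (gens q i)) := by
  obtain ⟨M₀, hM₀⟩ := exists_pullback_X_zero C.h_homogeneous C.h_ne_zero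
  obtain ⟨l, a, b, c, hl, hq⟩ := exists_eq_of_isHomogeneous_two
    (isHomogeneous_pullback M₀⁻¹ C.q_homogeneous)
  -- Otherwise the pulled-back `q` is a multiple of `X 0`, so that `h` divides `q`.
  have habc : ¬ (a = 0 ∧ b = 0 ∧ c = 0) := by
    rintro ⟨rfl, rfl, rfl⟩
    apply C.not_dvd
    have h1 := congrArg (pullback M₀) hq
    rw [pullback_apply_inv] at h1
    rw [h1, ← hM₀]
    exact map_dvd _ (by simp)
  obtain ⟨p, q, r, s, hdet, hfac⟩ := exists_linear_factors a b c habc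
  -- `B` fixes `X 0`, so `B * M₀` still carries `X 0` to `h`; on the other two coordinates it is
  -- given by the linear factors.
  let B : GL (Fin 3) ℂ := Matrix.GeneralLinearGroup.mkOfDetNeZero
    !![1, 0, 0; 0, p, q; 0, r, s] (by simpa [Matrix.det_fin_three] using hdet)
  have hB0 : pullback B (X 0) = X 0 := by
    rw [pullback_X, Fin.sum_univ_three]
    simp [B, Matrix.GeneralLinearGroup.mkOfDetNeZero]
  have hB1 : pullback B (X 1) = p • X 1 + q • X 2 := by
    rw [pullback_X, Fin.sum_univ_three]
    simp [B, Matrix.GeneralLinearGroup.mkOfDetNeZero]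
  have hB2 : pullback B (X 2) = r • X 1 + s • X 2 := by
    rw [pullback_X, Fin.sum_univ_three]
    simp [B, Matrix.GeneralLinearGroup.mkOfDetNeZero]
  have hh : pullback (B * M₀) (X 0) = C.h := by rw [pullback_mul, hB0, hM₀]
  obtain ⟨q₁, hq₁, hq₂⟩ : ∃ q₁ : MvPolynomial (Fin 3) ℂ, (q₁ = X 1 * X 2 ∨ q₁ = X 2 ^ 2) ∧
      pullback B q₁ = a • X 1 ^ 2 + b • (X 1 * X 2) + c • X 2 ^ 2 := by
    rcases hfac with ⟨rfl, rfl, rfl⟩ | ⟨rfl, rfl, rfl⟩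
    · refine ⟨_, Or.inl rfl, ?_⟩
      rw [map_mul, hB1, hB2]
      simp only [smul_eq_C_mul, map_add, map_mul]
      ring
    · refine ⟨_, Or.inr rfl, ?_⟩
      rw [map_pow, hB2]
      simp only [smul_eq_C_mul, map_mul, map_pow, map_ofNat]
      ring
  -- Modulo `h` the equation `q` becomes the monomial `q₁`; the multiple of `h` does not change the
  -- space of equations.
  have hCq : C.q = pullback M₀ l * C.h + pullback (B * M₀) q₁ := by
    rw [← pullback_apply_inv M₀ C.q, hq, map_add, map_mul, hM₀, pullback_mul, hq₂]
  have hl₀ : (pullback M₀ l).IsHomogeneous 1 := isHomogeneous_pullback M₀ hl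
  refine ⟨B * M₀, q₁, hq₁, le_antisymm ?_ (Submodule.span_le.2 ?_)⟩
  · intro f hf
    obtain ⟨l', k, hl', rfl⟩ := (C.mem_W_iff f).1 hf
    obtain ⟨u, v, w, huvw⟩ := exists_eq_of_isHomogeneous_one (isHomogeneous_pullback (B * M₀)⁻¹
      (Submodule.add_mem (homogeneousSubmodule _ _ _) hl' (Submodule.smul_mem _ k hl₀)))
    have h1 := congrArg (pullback (B * M₀)) huvw
    rw [pullback_apply_inv] at h1
    rw [Submodule.mem_span_range_iff_exists_fun]
    refine ⟨![u, v, w, k], ?_⟩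
    have h2 : l' * C.h + k • C.q = (l' + k • pullback M₀ l) * C.h + k • pullback (B * M₀) q₁ := by
      rw [hCq, smul_add, add_mul, smul_mul_assoc, add_assoc]
    rw [h2, h1, ← hh]
    simp only [Fin.sum_univ_four, gens, Matrix.cons_val, map_add, map_mul, map_pow, map_smul]
    simp only [smul_eq_C_mul]
    ring
  · rintro _ ⟨i, rfl⟩
    have hX : ∀ i, (pullback (B * M₀) (X i)).IsHomogeneous 1 := fun i =>
      isHomogeneous_pullback _ (isHomogeneous_X ℂ i)
    refine (C.mem_W_iff _).2 ?_
    fin_cases i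
    · exact ⟨_, 0, hX 0, by simp [gens, hh, pow_two]⟩
    · exact ⟨_, 0, hX 1, by simp [gens, hh, mul_comm]⟩
    · exact ⟨_, 0, hX 2, by simp [gens, hh, mul_comm]⟩
    · exact ⟨-pullback M₀ l, 1, hl₀.neg, by simp [gens, hCq]⟩

theorem exists_eval_pullback {n : ℕ} (M : GL (Fin n) ℂ) (v : Fin n → ℂ) :
    ∃ x : Fin n → ℂ, ∀ p, eval x (pullback M p) = eval v p := by
  refine ⟨(M⁻¹ : GL (Fin n) ℂ).1.mulVec v, fun p => ?_⟩
  rw [pullback_apply, eval_pullbackHom, Matrix.mulVec_mulVec, ← Units.val_mul, mul_inv_cancel]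
  simp

theorem linearIndependent_gens {q : MvPolynomial (Fin 3) ℂ} (hq : q = X 1 * X 2 ∨ q = X 2 ^ 2) :
    LinearIndependent ℂ (gens q) := by
  rw [Fintype.linearIndependent_iff]
  intro g hg
  have h : ∀ v : Fin 3 → ℂ, g 0 * v 0 ^ 2 + g 1 * (v 0 * v 1) + g 2 * (v 0 * v 2) +
      g 3 * eval v q = 0 := by
    intro v
    simpa [Fin.sum_univ_four, gens, smul_eval] using congrArg (eval v) hg
  have h0 := h ![1, 0, 0]
  have h1 := h ![1, 1, 0]
  have h2 := h ![1, 0, 1]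
  have h3 := h ![0, 1, 1]
  rcases hq with rfl | rfl <;> simp at h0 h1 h2 h3 <;> intro i <;> fin_cases i <;> simp <;> grind

/-- There is a basis of the space of equations of the form `z², zx, zy, q` with `q = xy` or
`q = y²`, where `z`, `x`, `y` are linear coordinates. -/
theorem HyperplaneQuadric.exists_basis (C : HyperplaneQuadric 3) :
    ∃ (M : GL (Fin 3) ℂ) (q : MvPolynomial (Fin 3) ℂ) (e : Module.Basis (Fin 4) ℂ C.W),
      (q = X 1 * X 2 ∨ q = X 2 ^ 2) ∧
      ∀ i, (e i : MvPolynomial (Fin 3) ℂ) = pullback M (gens q i) := by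
  obtain ⟨M, q, hq, hW⟩ := C.exists_W_eq_span
  have hli : LinearIndependent ℂ fun i => pullback M (gens q i) :=
    (linearIndependent_gens hq).map' (pullback M).toLinearMap
      (LinearMap.ker_eq_bot.2 (pullback M).injective)
  refine ⟨M, q, (Module.Basis.span hli).map (LinearEquiv.ofEq _ _ hW.symm), hq, fun i => ?_⟩
  rw [Module.Basis.map_apply, LinearEquiv.coe_ofEq_apply, Module.Basis.span_apply]

/-- A linear change of the coordinates `z`, `x`, `y` acts on the matrices of congruences. -/
theorem HasMatrix.conj_gens {W₀ : PolySpace 3} (e : Module.Basis (Fin 4) ℂ W₀) {M : GL (Fin 3) ℂ}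
    {q : MvPolynomial (Fin 3) ℂ} (he : ∀ i, (e i : MvPolynomial (Fin 3) ℂ) = pullback M (gens q i))
    {c : CongQuot W₀} {S : Matrix (Fin 4) (Fin 4) ℂ} (h : HasMatrix e c S)
    (B : Matrix (Fin 3) (Fin 3) ℂ) (hB : B.det ≠ 0) (P : Matrix (Fin 4) (Fin 4) ℂ)
    (hP : ∀ j, aeval (fun i => ∑ k, B i k • (X k : MvPolynomial (Fin 3) ℂ)) (gens q j)
      = ∑ i, P i j • gens q i) :
    HasMatrix e c (P * S * P.transpose) := by
  let B' : GL (Fin 3) ℂ := Matrix.GeneralLinearGroup.mkOfDetNeZero B hB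
  -- The basis consists of pull-backs along `M`, so the substitution `B` in the coordinates `z`,
  -- `x`, `y` is conjugated by `M`.
  refine h.conj e (M⁻¹ * (B' * M)) P fun j => ?_
  rw [he, pullback_mul, pullback_mul, pullback_inv_apply]
  have h1 : ∀ p, pullback B' p
      = aeval (fun i => ∑ k, B i k • (X k : MvPolynomial (Fin 3) ℂ)) p := fun p => by
    simp only [smul_eq_C_mul]; rfl
  rw [h1, hP, map_sum]
  simp only [map_smul, he]

theorem RationalLift.IsQuadraticCongruence.sum_matrix_gens {W₀ : PolySpace 3}
    {F : RationalLift 3 W₀} (h : F.IsQuadraticCongruence) (e : Module.Basis (Fin 4) ℂ W₀)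
    {M : GL (Fin 3) ℂ} {q : MvPolynomial (Fin 3) ℂ}
    (he : ∀ i, (e i : MvPolynomial (Fin 3) ℂ) = pullback M (gens q i)) (v : Fin 3 → ℂ) :
    ∑ i, ∑ j, F.matrix e h i j * (eval v (gens q i) * eval v (gens q j)) = 0 := by
  obtain ⟨x, hx⟩ := exists_eval_pullback M v
  simpa only [he, hx] using h.sum_matrix e x

theorem finite_setOf_sq_eq (a : ℂ) : {b : ℂ | b ^ 2 = a}.Finite := by
  obtain ⟨r, rfl⟩ := IsAlgClosed.exists_pow_nat_eq a (n := 2) (by norm_num)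
  refine (Set.toFinite {r, -r}).subset fun b hb => ?_
  simpa using sq_eq_sq_iff_eq_or_eq_neg.1 hb

/-! ### Two distinct points -/

section TwoPoints

/-- The tensors with symmetric part `z² · xy - zx · zy`, in the basis `z²`, `zx`, `zy`, `xy`. -/
def splitMatrix (u v : Fin 3 → ℂ) : Matrix (Fin 4) (Fin 4) ℂ :=
  !![0, v 0, u 0, 1 + u 1 + v 1;
    -v 0, 0, -1 + u 1 - v 1, u 2;
    -u 0, -1 - u 1 + v 1, 0, v 2;
    1 - u 1 - v 1, -u 2, -v 2, 0]

/-- The discriminant of a binary quadratic form. -/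
def disc (u : Fin 3 → ℂ) : ℂ := u 0 * u 2 - u 1 ^ 2

/-- The substitution `x ↦ b x + c z` on binary quadratic forms, up to a scalar. -/
def triangular (b c : ℂ) (u : Fin 3 → ℂ) : Fin 3 → ℂ :=
  ![(u 0 + 2 * u 1 * c + u 2 * c ^ 2) / b, u 1 + c * u 2, b * u 2]

/-- Normal forms of binary quadratic forms of discriminant `d` under triangular substitutions. -/
def normalForms (d : ℂ) : Set (Fin 3 → ℂ) :=
  {![d, 0, 1], ![1, 0, 0]} ∪ (fun b => ![0, b, 0]) '' {b : ℂ | b ^ 2 = -d}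

theorem finite_normalForms (d : ℂ) : (normalForms d).Finite :=
  (Set.toFinite _).union ((finite_setOf_sq_eq _).image _)

theorem exists_triangular_mem_normalForms (u : Fin 3 → ℂ) :
    ∃ b c : ℂ, b ≠ 0 ∧ triangular b c u ∈ normalForms (disc u) := by
  -- If `u 2 ≠ 0`, complete the square. If only `u 2 = 0`, a translation kills `u 0`. If `u 1 = u 2
  -- = 0`, scale `u 0` to 1 unless it is 0.
  by_cases h2 : u 2 = 0
  · by_cases h1 : u 1 = 0
    · by_cases h0 : u 0 = 0
      · refine ⟨1, 0, one_ne_zero, Or.inr ⟨0, ?_, ?_⟩⟩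
        · simp [disc, h1, h2]
        · simp [triangular, h0, h1, h2]
      · refine ⟨u 0, 0, h0, Or.inl (Or.inr ?_)⟩
        simp [triangular, h0, h1, h2]
    · refine ⟨1, -u 0 / (2 * u 1), one_ne_zero, Or.inr ⟨u 1, ?_, ?_⟩⟩
      · simp [disc, h2]
      · have : u 0 + 2 * u 1 * (-u 0 / (2 * u 1)) = 0 := by field_simp; ring
        simp [triangular, h2, this]
  · refine ⟨(u 2)⁻¹, -u 1 / u 2, inv_ne_zero h2, Or.inl (Or.inl ?_)⟩
    have h3 : (u 0 + 2 * u 1 * (-u 1 / u 2) + u 2 * (-u 1 / u 2) ^ 2) / (u 2)⁻¹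
        = disc u := by unfold disc; field_simp; ring
    have h4 : u 1 + -u 1 / u 2 * u 2 = 0 := by field_simp; ring
    have h5 : (u 2)⁻¹ * u 2 = 1 := inv_mul_cancel₀ h2
    rw [triangular, h3, h4, h5]

theorem det_splitMatrix (u v : Fin 3 → ℂ) :
    (splitMatrix u v).det = 1 + 2 * (disc u + disc v) + (disc u - disc v) ^ 2 := by
  simp [splitMatrix, disc, Matrix.det_succ_row_zero, Fin.sum_univ_succ, Fin.succAbove]
  ring

theorem det_splitMatrix_add (u v : Fin 3 → ℂ) :
    (splitMatrix u v + (1 : ℂ) • (splitMatrix u v).transpose).det = 16 := by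
  have : splitMatrix u v + (1 : ℂ) • (splitMatrix u v).transpose
      = !![0, 0, 0, 2; 0, 0, -2, 0; 0, -2, 0, 0; 2, 0, 0, 0] := by
    ext i j
    fin_cases i <;> fin_cases j <;> simp [splitMatrix] <;> ring
  rw [this]
  simp [Matrix.det_succ_row_zero, Fin.sum_univ_succ, Fin.succAbove]
  norm_num

/-- The Pfaffian of the antisymmetric part is `disc v - disc u`. -/
theorem det_splitMatrix_sub (u v : Fin 3 → ℂ) :
    (splitMatrix u v + (-1 : ℂ) • (splitMatrix u v).transpose).det
      = 16 * (disc u - disc v) ^ 2 := by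
  have : splitMatrix u v + (-1 : ℂ) • (splitMatrix u v).transpose = (2 : ℂ) •
      !![0, v 0, u 0, u 1 + v 1; -v 0, 0, u 1 - v 1, u 2; -u 0, - u 1 + v 1, 0, v 2;
        - u 1 - v 1, -u 2, -v 2, 0] := by
    ext i j
    fin_cases i <;> fin_cases j <;> simp [splitMatrix] <;> ring
  rw [this, Matrix.det_smul]
  simp [disc, Matrix.det_succ_row_zero, Fin.sum_univ_succ, Fin.succAbove]
  ring

/-! ### Triangular substitutions and finiteness for two points -/

variable {W₀ : PolySpace 3} {e : Module.Basis (Fin 4) ℂ W₀} {M : GL (Fin 3) ℂ}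
  {c : CongQuot W₀}

theorem HasMatrix.splitMatrix_left
    (he : ∀ i, (e i : MvPolynomial (Fin 3) ℂ) = pullback M (gens (X 1 * X 2) i))
    {u v : Fin 3 → ℂ} (h : HasMatrix e c (splitMatrix u v))
    {b : ℂ} (hb : b ≠ 0) (d : ℂ) : HasMatrix e c (splitMatrix (triangular b d u) v) := by
  -- The substitution `x ↦ b x + d z` multiplies the relation `z²·xy - zx·zy` and the form `v` by
  -- `b`; dividing by `b` restores both.
  have h1 := (h.conj_gens e he !![1, 0, 0; d, b, 0; 0, 0, 1] (by simpa [Matrix.det_fin_three])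
    !![1, d, 0, 0; 0, b, 0, 0; 0, 0, 1, d; 0, 0, 0, b] (fun j => by
      fin_cases j <;>
        simp [gens, Fin.sum_univ_succ, smul_eq_C_mul] <;> ring)).smul e (inv_ne_zero hb)
  convert h1 using 1
  ext i j
  simp only [Matrix.smul_apply, Matrix.mul_apply, Matrix.transpose_apply, Fin.sum_univ_four]
  fin_cases i <;> fin_cases j <;> simp [splitMatrix, triangular, hb] <;> field_simp <;> ring

theorem HasMatrix.splitMatrix_right
    (he : ∀ i, (e i : MvPolynomial (Fin 3) ℂ) = pullback M (gens (X 1 * X 2) i))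
    {u v : Fin 3 → ℂ} (h : HasMatrix e c (splitMatrix u v))
    {b : ℂ} (hb : b ≠ 0) (d : ℂ) : HasMatrix e c (splitMatrix u (triangular b d v)) := by
  have h1 := (h.conj_gens e he !![1, 0, 0; 0, 1, 0; d, 0, b] (by simpa [Matrix.det_fin_three])
    !![1, 0, d, 0; 0, 1, 0, d; 0, 0, b, 0; 0, 0, 0, b] (fun j => by
      fin_cases j <;>
        simp [gens, Fin.sum_univ_succ, smul_eq_C_mul] <;> ring)).smul e (inv_ne_zero hb)
  convert h1 using 1
  ext i j
  simp only [Matrix.smul_apply, Matrix.mul_apply, Matrix.transpose_apply, Fin.sum_univ_four]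
  fin_cases i <;> fin_cases j <;> simp [splitMatrix, triangular, hb] <;> field_simp <;> ring

/-- Among the ten products of two generators only `z²·xy` and `zx·zy` coincide. Evaluation at enough
points isolates the other coefficients and leaves one free number `t`, nonzero as `S` is not
antisymmetric. -/
theorem exists_smul_eq_splitMatrix {S : Matrix (Fin 4) (Fin 4) ℂ}
    (hS : ∀ v : Fin 3 → ℂ, ∑ i, ∑ j, S i j *
      (eval v (gens (X 1 * X 2) i) * eval v (gens (X 1 * X 2) j)) = 0)
    (hne : S + S.transpose ≠ 0) : ∃ (k : ℂ) (u v : Fin 3 → ℂ), k ≠ 0 ∧ k • S = splitMatrix u v := by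
  simp only [Fin.sum_univ_four, gens, Matrix.cons_val, map_mul, map_pow, eval_X] at hS
  have k0 := hS ![1, 0, 0]
  have k1 := hS ![0, 1, 1]
  have k2 := hS ![1, 1, 0]
  have k3 := hS ![1, -1, 0]
  have k4 := hS ![1, 0, 1]
  have k5 := hS ![1, 0, -1]
  have k6 := hS ![1, 1, 1]
  have k7 := hS ![1, 1, -1]
  have k8 := hS ![1, -1, 1]
  have k9 := hS ![1, -1, -1]
  simp only [Matrix.cons_val] at k0 k1 k2 k3 k4 k5 k6 k7 k8 k9
  clear hS
  have s00 : S 0 0 = 0 := by linear_combination k0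
  have s33 : S 3 3 = 0 := by linear_combination k1
  have s11 : S 1 1 = 0 := by linear_combination (k2 + k3) / 2 - k0
  have s22 : S 2 2 = 0 := by linear_combination (k4 + k5) / 2 - k0
  have s10 : S 1 0 = -S 0 1 := by linear_combination (k2 - k3) / 2
  have s20 : S 2 0 = -S 0 2 := by linear_combination (k4 - k5) / 2
  have s31 : S 3 1 = -S 1 3 := by linear_combination (k6 - k7 + k8 - k9) / 4 - (k4 - k5) / 2
  have s32 : S 3 2 = -S 2 3 := by linear_combination (k6 + k7 - k8 - k9) / 4 - (k2 - k3) / 2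
  have s21 : S 2 1 = -S 1 2 - (S 0 3 + S 3 0) := by linear_combination (k6 - k7 - k8 + k9) / 4
  clear k0 k1 k2 k3 k4 k5 k6 k7 k8 k9
  obtain ⟨t, ht⟩ : ∃ t, S 3 0 = t - S 0 3 := ⟨S 3 0 + S 0 3, by ring⟩
  have hS : S = !![0, S 0 1, S 0 2, S 0 3; -S 0 1, 0, S 1 2, S 1 3;
      -S 0 2, -S 1 2 - t, 0, S 2 3; t - S 0 3, -S 1 3, -S 2 3, 0] := by
    rw [ht, add_sub_cancel] at s21
    ext i j
    fin_cases i <;> fin_cases j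
    exacts [s00, rfl, rfl, rfl, s10, s11, rfl, rfl, s20, s21, s22, rfl, ht, s31, s32, s33]
  have ht0 : t ≠ 0 := by
    rintro rfl
    apply hne
    rw [hS]
    ext i j
    fin_cases i <;> fin_cases j <;> simp
  -- In `splitMatrix` the entries `(0,3)` and `(3,0)` add up to 2; `u 1` and `v 1` come from solving
  -- for their sum and difference.
  refine ⟨2 / t, ![2 / t * S 0 2, (S 0 3 + S 1 2) / t, 2 / t * S 1 3],
    ![2 / t * S 0 1, (S 0 3 - S 1 2) / t - 1, 2 / t * S 2 3], div_ne_zero two_ne_zero ht0, ?_⟩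
  conv_lhs => rw [hS]
  ext i j
  fin_cases i <;> fin_cases j <;> simp [splitMatrix] <;> field_simp <;> ring

theorem exists_hasMatrix_splitMatrix
    (he : ∀ i, (e i : MvPolynomial (Fin 3) ℂ) = pullback M (gens (X 1 * X 2) i))
    (c : CongQuot W₀) : ∃ u v, HasMatrix e c (splitMatrix u v) := by
  obtain ⟨F, hF, hc⟩ := exists_hasMatrix e c
  obtain ⟨k, u, v, hk, h⟩ := exists_smul_eq_splitMatrix (hF.sum_matrix_gens e he)
    (hF.matrix_not_antisymm e)
  exact ⟨u, v, h ▸ hc.smul e hk⟩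

theorem finite_fiber_of_splitMatrix
    (he : ∀ i, (e i : MvPolynomial (Fin 3) ℂ) = pullback M (gens (X 1 * X 2) i))
    (y : IsomQuot W₀) : (quotientMap W₀ ⁻¹' {y}).Finite := by
  obtain ⟨r, hr⟩ := HasMatrix.exists_invariant e y 1
  obtain ⟨r', hr'⟩ := HasMatrix.exists_invariant e y (-1)
  -- `m` is the squared difference of the two discriminants and `s` is their sum.
  let m : ℂ := r' / r
  let s : ℂ := (16 / r - 1 - m) / 2
  refine finite_of_normalForms e _ (⋃ d ∈ {d : ℂ | (2 * d - s) ^ 2 = m},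
    Set.image2 splitMatrix (normalForms d) (normalForms (s - d))) ?_ fun c hc => ?_
  · refine Set.Finite.biUnion ?_ fun d _ =>
      Set.Finite.image2 _ (finite_normalForms _) (finite_normalForms _)
    refine (finite_setOf_sq_eq m).preimage (f := fun d : ℂ => 2 * d - s) fun a _ b _ hab => ?_
    simpa using hab
  · obtain ⟨u, v, huv⟩ := exists_hasMatrix_splitMatrix he c
    have h1 := hr c hc _ huv
    have h2 := hr' c hc _ huv
    rw [det_splitMatrix_add] at h1
    rw [det_splitMatrix_sub] at h2
    have hd := det_splitMatrix u v
    have hr0 : r ≠ 0 := by rintro rfl; simp at h1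
    have hD : (splitMatrix u v).det = 16 / r := by field_simp; linear_combination -h1
    rw [hD] at h2 hd
    have hm : (disc u - disc v) ^ 2 = m := by
      simp only [m]; field_simp at h2 ⊢; linear_combination h2
    have hs : disc v = s - disc u := by
      simp only [s]; rw [← hm]; linear_combination -hd / 2
    obtain ⟨b, d, hb, hu⟩ := exists_triangular_mem_normalForms u
    obtain ⟨b', d', hb', hv⟩ := exists_triangular_mem_normalForms v
    refine ⟨splitMatrix (triangular b d u) (triangular b' d' v), ?_,
      (huv.splitMatrix_left he hb d).splitMatrix_right he hb' d'⟩
    refine Set.mem_biUnion (x := disc u) ?_ (Set.mem_image2_of_mem hu (hs ▸ hv))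
    change (2 * disc u - s) ^ 2 = m
    rw [← hm, hs]
    ring

end TwoPoints

/-! ### A double point -/

section DoublePoint

/-- The tensors with symmetric part `z² · y² - (zy)²`, in the basis `z²`, `zx`, `zy`, `y²`. -/
def coneMatrix (a b c u v w : ℂ) : Matrix (Fin 4) (Fin 4) ℂ :=
  !![0, -u, a, 1 + b;
    u, 0, v, w;
    -a, -v, -2, c;
    1 - b, -w, -c, 0]

theorem det_coneMatrix (a b c u v w : ℂ) :
    (coneMatrix a b c u v w).det = (u * c + w * a - v * b) ^ 2 + 4 * u * w - v ^ 2 := by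
  simp [coneMatrix, Matrix.det_succ_row_zero, Fin.sum_univ_succ, Fin.succAbove]
  ring

/-- Up to sign, `u c + w a - v b` is the Pfaffian of the antisymmetric part. Here the symmetric part
is degenerate, so `a = 1` would give no information. -/
theorem det_coneMatrix_sub (a b c u v w : ℂ) :
    (coneMatrix a b c u v w + (-1 : ℂ) • (coneMatrix a b c u v w).transpose).det
      = 16 * (u * c + w * a - v * b) ^ 2 := by
  have : coneMatrix a b c u v w + (-1 : ℂ) • (coneMatrix a b c u v w).transpose = (2 : ℂ) •
      !![0, -u, a, b; u, 0, v, w; -a, -v, 0, c; -b, -w, -c, 0] := by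
    ext i j
    fin_cases i <;> fin_cases j <;> simp [coneMatrix] <;> ring
  rw [this, Matrix.det_smul]
  simp [Matrix.det_succ_row_zero, Fin.sum_univ_succ, Fin.succAbove]
  ring

theorem exists_smul_eq_coneMatrix {S : Matrix (Fin 4) (Fin 4) ℂ}
    (hS : ∀ v : Fin 3 → ℂ, ∑ i, ∑ j, S i j *
      (eval v (gens (X 2 ^ 2) i) * eval v (gens (X 2 ^ 2) j)) = 0)
    (hne : S + S.transpose ≠ 0) :
    ∃ k a b c u v w : ℂ, k ≠ 0 ∧ k • S = coneMatrix a b c u v w := by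
  simp only [Fin.sum_univ_four, gens, Matrix.cons_val, map_mul, map_pow, eval_X] at hS
  have k0 := hS ![1, 0, 0]
  have k1 := hS ![0, 0, 1]
  have k2 := hS ![1, 1, 0]
  have k3 := hS ![1, -1, 0]
  -- On `x = 0`, `z = 1` the form is a quartic in `y`; the values at `±1` and `±2` separate the
  -- coefficients of `y` and `y³`.
  have k4 := hS ![1, 0, 1]
  have k5 := hS ![1, 0, -1]
  have k6 := hS ![1, 0, 2]
  have k7 := hS ![1, 0, -2]
  have k8 := hS ![1, 1, 1]
  have k9 := hS ![1, 1, -1]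
  simp only [Matrix.cons_val] at k0 k1 k2 k3 k4 k5 k6 k7 k8 k9
  clear hS
  have s00 : S 0 0 = 0 := by linear_combination k0
  have s33 : S 3 3 = 0 := by linear_combination k1
  have s11 : S 1 1 = 0 := by linear_combination (k2 + k3) / 2 - k0
  have s10 : S 1 0 = -S 0 1 := by linear_combination (k2 - k3) / 2
  have s32 : S 3 2 = -S 2 3 := by linear_combination (k6 - k7) / 12 - (k4 - k5) / 6
  have s20 : S 2 0 = -S 0 2 := by
    linear_combination (k4 - k5) / 2 - ((k6 - k7) / 12 - (k4 - k5) / 6)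
  have s22 : S 2 2 = -(S 0 3 + S 3 0) := by linear_combination (k4 + k5) / 2 - k0 - k1
  have s21 : S 2 1 = -S 1 2 := by linear_combination (k8 - k9 - k4 + k5) / 2
  have s31 : S 3 1 = -S 1 3 := by linear_combination (k8 + k9 - k4 - k5) / 2 - k2 + k0
  clear k0 k1 k2 k3 k4 k5 k6 k7 k8 k9
  obtain ⟨t, ht⟩ : ∃ t, S 3 0 = t - S 0 3 := ⟨S 3 0 + S 0 3, by ring⟩
  have hS : S = !![0, S 0 1, S 0 2, S 0 3; -S 0 1, 0, S 1 2, S 1 3;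
      -S 0 2, -S 1 2, -t, S 2 3; t - S 0 3, -S 1 3, -S 2 3, 0] := by
    rw [ht, add_sub_cancel] at s22
    ext i j
    fin_cases i <;> fin_cases j
    exacts [s00, rfl, rfl, rfl, s10, s11, rfl, rfl, s20, s21, s22, rfl, ht, s31, s32, s33]
  have ht0 : t ≠ 0 := by
    rintro rfl
    apply hne
    rw [hS]
    ext i j
    fin_cases i <;> fin_cases j <;> simp
  refine ⟨2 / t, 2 / t * S 0 2, 2 / t * S 0 3 - 1, 2 / t * S 2 3, -(2 / t * S 0 1), 2 / t * S 1 2,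
    2 / t * S 1 3, div_ne_zero two_ne_zero ht0, ?_⟩
  conv_lhs => rw [hS]
  ext i j
  fin_cases i <;> fin_cases j <;> simp [coneMatrix] <;> field_simp <;> ring

/-! ### Coordinate changes and finiteness for a double point -/

variable {W₀ : PolySpace 3} {e : Module.Basis (Fin 4) ℂ W₀} {M : GL (Fin 3) ℂ}
  {κ : CongQuot W₀}

theorem exists_hasMatrix_coneMatrix
    (he : ∀ i, (e i : MvPolynomial (Fin 3) ℂ) = pullback M (gens (X 2 ^ 2) i))
    (κ : CongQuot W₀) : ∃ a b c u v w, HasMatrix e κ (coneMatrix a b c u v w) := by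
  obtain ⟨F, hF, hc⟩ := exists_hasMatrix e κ
  obtain ⟨k, a, b, c, u, v, w, hk, h⟩ := exists_smul_eq_coneMatrix (hF.sum_matrix_gens e he)
    (hF.matrix_not_antisymm e)
  exact ⟨a, b, c, u, v, w, h ▸ hc.smul e hk⟩

/-- The substitution `z ↦ t z`, `x ↦ t k x`. -/
theorem HasMatrix.coneMatrix_scale
    (he : ∀ i, (e i : MvPolynomial (Fin 3) ℂ) = pullback M (gens (X 2 ^ 2) i))
    {a b c u v w : ℂ} (h : HasMatrix e κ (coneMatrix a b c u v w)) {t k : ℂ} (ht : t ≠ 0)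
    (hk : k ≠ 0) :
    HasMatrix e κ (coneMatrix (t * a) b (c / t) (k * t ^ 2 * u) (k * t * v) (k * w)) := by
  have h1 := (h.conj_gens e he !![t, 0, 0; 0, t * k, 0; 0, 0, 1]
    (by simp [Matrix.det_fin_three, ht, hk])
    !![t ^ 2, 0, 0, 0; 0, t ^ 2 * k, 0, 0; 0, 0, t, 0; 0, 0, 0, 1] (fun j => by
      fin_cases j <;>
        simp [gens, Fin.sum_univ_succ, smul_eq_C_mul] <;> ring)).smul e
        (inv_ne_zero (pow_ne_zero 2 ht))
  convert h1 using 1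
  ext i j
  simp only [Matrix.smul_apply, Matrix.mul_apply, Matrix.transpose_apply, Fin.sum_univ_four]
  fin_cases i <;> fin_cases j <;> simp [coneMatrix, ht] <;> field_simp

/-- The substitution `x ↦ x + p z + q y`. -/
theorem HasMatrix.coneMatrix_shear
    (he : ∀ i, (e i : MvPolynomial (Fin 3) ℂ) = pullback M (gens (X 2 ^ 2) i))
    {a b c u v w : ℂ} (h : HasMatrix e κ (coneMatrix a b c u v w)) (p q : ℂ) :
    HasMatrix e κ (coneMatrix (a + p * v - q * u) (b + p * w) (c + q * w) u v w) := by
  have h1 := h.conj_gens e he !![1, 0, 0; p, 1, q; 0, 0, 1] (by simp [Matrix.det_fin_three])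
    !![1, p, 0, 0; 0, 1, 0, 0; 0, q, 1, 0; 0, 0, 0, 1] (fun j => by
      fin_cases j <;> simp [gens, Fin.sum_univ_succ, smul_eq_C_mul] <;> ring)
  convert h1 using 1
  ext i j
  simp only [Matrix.mul_apply, Matrix.transpose_apply, Fin.sum_univ_four]
  fin_cases i <;> fin_cases j <;> simp [coneMatrix] <;> ring

/-- The substitution `y ↦ y + r z`. -/
theorem HasMatrix.coneMatrix_translate
    (he : ∀ i, (e i : MvPolynomial (Fin 3) ℂ) = pullback M (gens (X 2 ^ 2) i))
    {a b c u v w : ℂ} (h : HasMatrix e κ (coneMatrix a b c u v w)) (r : ℂ) :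
    HasMatrix e κ (coneMatrix (a + 2 * r * b + r ^ 2 * c) (b + r * c) c
      (u + r * v + r ^ 2 * w) (v + 2 * r * w) w) := by
  have hC : (C 2 : MvPolynomial (Fin 3) ℂ) = 2 := map_ofNat C 2
  have h1 := h.conj_gens e he !![1, 0, 0; 0, 1, 0; r, 0, 1] (by simp [Matrix.det_fin_three])
    !![1, 0, r, r ^ 2; 0, 1, 0, 0; 0, 0, 1, 2 * r; 0, 0, 0, 1] (fun j => by
      fin_cases j <;> simp [gens, Fin.sum_univ_succ, smul_eq_C_mul, hC] <;> ring)
  convert h1 using 1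
  ext i j
  simp only [Matrix.mul_apply, Matrix.transpose_apply, Fin.sum_univ_four]
  fin_cases i <;> fin_cases j <;> simp [coneMatrix] <;> ring

/-- The normal forms whose invariant `det (S - ᵗS) / det S` is `r`. -/
def coneNormalForms (r : ℂ) : Set (Matrix (Fin 4) (Fin 4) ℂ) :=
  {coneMatrix 0 0 0 1 0 1, coneMatrix 0 0 1 1 0 0} ∪
    (fun u => coneMatrix 1 0 0 u 0 1) '' {u : ℂ | 16 = r * (1 + 4 * u)} ∪
    Set.image2 (fun b c => coneMatrix 0 b c 0 1 0) {b : ℂ | 16 * b ^ 2 = r * (b ^ 2 - 1)} {0, 1}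

theorem finite_coneNormalForms (r : ℂ) : (coneNormalForms r).Finite := by
  refine ((Set.toFinite _).union (Set.Finite.image _ ?_)).union
    (Set.Finite.image2 _ ?_ (Set.toFinite _))
  · refine (Set.toFinite {(16 / r - 1) / 4}).subset fun u hu => ?_
    simp only [Set.mem_ofPred_eq] at hu
    have hr : r ≠ 0 := by rintro rfl; simp at hu
    rw [Set.mem_singleton_iff]
    field_simp
    linear_combination -hu
  · refine (finite_setOf_sq_eq (-r / (16 - r))).subset fun b hb => ?_
    simp only [Set.mem_ofPred_eq] at hb ⊢
    -- For `r = 16` the equation reads `0 = -16` and has no solution.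
    have hr : 16 - r ≠ 0 := by
      intro h0
      have h1 : r = 16 := by linear_combination -h0
      rw [h1] at hb
      have h2 : (16 : ℂ) = 0 := by linear_combination hb
      norm_num at h2
    field_simp
    linear_combination hb

theorem exists_mem_coneNormalForms
    (he : ∀ i, (e i : MvPolynomial (Fin 3) ℂ) = pullback M (gens (X 2 ^ 2) i)) {r : ℂ}
    (hr : ∀ S : Matrix (Fin 4) (Fin 4) ℂ, HasMatrix e κ S →
      (S + (-1 : ℂ) • S.transpose).det = r * S.det) {a b c u v w : ℂ}
    (h : HasMatrix e κ (coneMatrix a b c u v w)) :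
    ∃ S ∈ coneNormalForms r, HasMatrix e κ S := by
  have hdet : ∀ {a b c u v w : ℂ}, HasMatrix e κ (coneMatrix a b c u v w) →
      (u * c + w * a - v * b) ^ 2 + 4 * u * w - v ^ 2 ≠ 0 := fun h => by
    rw [← det_coneMatrix]
    exact h.det_ne_zero e
  have hinv : ∀ {a b c u v w : ℂ}, HasMatrix e κ (coneMatrix a b c u v w) →
      16 * (u * c + w * a - v * b) ^ 2
        = r * ((u * c + w * a - v * b) ^ 2 + 4 * u * w - v ^ 2) := fun h => by
    rw [← det_coneMatrix, ← det_coneMatrix_sub]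
    exact hr _ h
  by_cases hw : w = 0
  · subst hw
    by_cases hv : v = 0
    · subst hv
      have h0 : u * c ≠ 0 := fun h0 => hdet h (by simp [h0])
      have hu := left_ne_zero_of_mul h0
      have hc := right_ne_zero_of_mul h0
      -- The translation kills `b`, the shear then kills `a`, and the scaling turns `c` and `u` into
      -- 1.
      have h1 := h.coneMatrix_translate he (-b / c)
      have h2 := h1.coneMatrix_shear he 0 ((a + 2 * (-b / c) * b + (-b / c) ^ 2 * c) / u)
      have h3 := h2.coneMatrix_scale he hc (k := 1 / (c ^ 2 * u))
        (one_div_ne_zero (mul_ne_zero (pow_ne_zero 2 hc) hu))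
      refine ⟨coneMatrix 0 0 1 1 0 0, Or.inl (Or.inl (Or.inr rfl)), ?_⟩
      convert h3 using 2 <;> field_simp <;> ring
    -- The translation kills `u` and the shear kills `a`; `b'` is the parameter left to the
    -- invariant.
    · have h1 := h.coneMatrix_translate he (-u / v)
      have h2 := h1.coneMatrix_shear he
        (-(a + 2 * (-u / v) * b + (-u / v) ^ 2 * c) / v) 0
      have h3 : ∃ b', HasMatrix e κ (coneMatrix 0 b' c 0 v 0) :=
        ⟨b + -u / v * c, by convert h2 using 2 <;> field_simp <;> ring⟩
      obtain ⟨b', h3⟩ := h3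
      have h4 : ∃ c' ∈ ({0, 1} : Set ℂ), HasMatrix e κ (coneMatrix 0 b' c' 0 1 0) := by
        by_cases hc : c = 0
        · refine ⟨0, by simp, ?_⟩
          convert h3.coneMatrix_scale he one_ne_zero (one_div_ne_zero hv) using 2 <;>
            simp [hc, hv]
        · refine ⟨1, by simp, ?_⟩
          convert h3.coneMatrix_scale he hc (one_div_ne_zero (mul_ne_zero hc hv)) using 2 <;>
            field_simp <;> simp
      obtain ⟨c', hc', h4⟩ := h4
      refine ⟨_, Or.inr (Set.mem_image2_of_mem ?_ hc'), h4⟩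
      simp only [Set.mem_ofPred_eq]
      linear_combination hinv h4
  -- Completing the square kills `v`; the two shear parameters then kill `b` and `c`.
  · have h1 := h.coneMatrix_translate he (-v / (2 * w))
    have h2 := h1.coneMatrix_shear he (-(b + -v / (2 * w) * c) / w) (-c / w)
    have h3 : ∃ a' u', HasMatrix e κ (coneMatrix a' 0 0 u' 0 w) :=
      ⟨_, _, by convert h2 using 2 <;> first | rfl | (field_simp; ring)⟩
    obtain ⟨a', u', h3⟩ := h3
    by_cases ha : a' = 0
    · subst ha
      have hu : u' ≠ 0 := by
        rintro rfl
        exact hdet h3 (by ring)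
      -- With `k = 1 / w`, the scaling sends `u'` to `t² u' / w`, which must be 1.
      obtain ⟨t, ht⟩ := IsAlgClosed.exists_pow_nat_eq (w / u') (n := 2) (by norm_num)
      have ht0 : t ≠ 0 := by
        rintro rfl
        exact div_ne_zero hw hu (by rw [← ht]; simp)
      refine ⟨coneMatrix 0 0 0 1 0 1, Or.inl (Or.inl (Or.inl rfl)), ?_⟩
      convert h3.coneMatrix_scale he ht0 (one_div_ne_zero hw) using 2 <;>
        (try rw [ht]) <;> field_simp <;> simp
    · have h4 : ∃ u'', HasMatrix e κ (coneMatrix 1 0 0 u'' 0 1) :=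
        ⟨_, by
          convert h3.coneMatrix_scale he (one_div_ne_zero ha) (one_div_ne_zero hw) using 2 <;>
            first | rfl | (field_simp <;> simp)⟩
      obtain ⟨u'', h4⟩ := h4
      refine ⟨_, Or.inl (Or.inr (Set.mem_image_of_mem _ ?_)), h4⟩
      simp only [Set.mem_ofPred_eq]
      linear_combination hinv h4

theorem finite_fiber_of_coneMatrix
    (he : ∀ i, (e i : MvPolynomial (Fin 3) ℂ) = pullback M (gens (X 2 ^ 2) i))
    (y : IsomQuot W₀) : (quotientMap W₀ ⁻¹' {y}).Finite := by
  obtain ⟨r, hr⟩ := HasMatrix.exists_invariant e y (-1)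
  refine finite_of_normalForms e _ _ (finite_coneNormalForms r) fun κ hκ => ?_
  obtain ⟨a, b, c, u, v, w, h⟩ := exists_hasMatrix_coneMatrix he κ
  exact exists_mem_coneNormalForms he (hr κ hκ) h

end DoublePoint

end

end QuadCong

theorem mainTheorem3 (C : QuadCong.HyperplaneQuadric 3) (y : QuadCong.IsomQuot C.W) :
    (QuadCong.quotientMap C.W ⁻¹' {y}).Finite := by
  obtain ⟨M, q, e, rfl | rfl, he⟩ := C.exists_basis
  · exact QuadCong.finite_fiber_of_splitMatrix he y
  · exact QuadCong.finite_fiber_of_coneMatrix he y
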